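/- **Setting.** Let $\mathcal C$ and $\mathcal P$ be finite disjoint sets of customers and providers, $\mathcal A=\mathcal C\cup\mathcal P$, and $T$ a number of rounds. The unknown utilities $u(a,a')\in[-1,1]$ are unstructured; $u(a,a')=0$ if $a,a'$ are on the same side, in particular $u(a,a)=0$. In round $t=1,\dots,T$ a set $\mathcal A_t\subseteq\mathcal A$ arrives; the platform, knowing $\mathcal A_t$ and the arrivals, matchings and feedback of earlier rounds, selects a matching $X^t$ between the customers and the providers in $\mathcal A_t$ and transfers $\tau^t\in\mathbb R^{\mathcal A_t}$ (not necessarily zero-sum); it then observes $u(a,\mu_{X^t}(a))+\eta_{a,t}$ for each $a\in\mathcal A_t$, where $\mu_X(a)$ is the partner of $a$ in $X$ ($\mu_X(a)=a$ if $a$ is unmatched) and the $\eta_{a,t}$ are independent $1$-subgaussian random variables. The platform's revenue is $-\sum_{t=1}^T\sum_{a\in\mathcal A_t}\tau^t_a$. For $\epsilon\ge 0$, the outcome $(X^t,\tau^t)$ is $\epsilon$-stable if $u(a,\mu_{X^t}(a))+\tau^t_a\ge-\epsilon$ for all $a\in\mathcal A_t$ and $$u(c,p)+u(p,c)-2\epsilon\le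 u(c,\mu_{X^t}(c))+\tau^t_c+u(p,\mu_{X^t}(p))+\tau^t_p$$ for all customers $c$ and providers $p$ in $\mathcal A_t$. It is stable if this holds with $\epsilon=0$. **Confidence intervals.** For a customer-provider pair $\{a,a'\}$, let $n_{aa'}$ be the number of earlier rounds in which it was matched and, if $n_{aa'}\ge1$, let $\hat u(a,a')$ be the mean of the feedback of $a$ in these rounds. The interval $[\ell(a,a'),v(a,a')]$ is $[-1,1]$ if $n_{aa'}=0$; otherwise its ends are $\hat u(a,a')\mp 8\sqrt{\log(|\mathcal A|T)/n_{aa'}}$, each replaced by the nearest point of $[-1,1]$. If $a,a'$ are on the same side, $\ell(a,a')=v(a,a')=0$. **Theorem.** There is a universal constant $K>0$ such that for all $\mathcal C,\mathcal P,T$ and $\epsilon\ge0$ there is an algorithm (a rule which selects each round's outcome as a measurable function of the information above), not depending on $u$, on the law of the noise or on future arrivals, of the following form: in each round it takes a matching $X$ on $\mathcal A_t$ and zero-sum transfers $\tau^*$ (i.e. $\tau^*_c+\tau^*_p=0$ for $(c,p)\in X$, and $\tau^*_a=0$ for unmatched $a$) such that $(X,\tau^*)$ is stable with respect to the upper confidence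 bounds $v$ in place of $u$, selects $X$, and sets $$\tau_a=\tau^*_a-\epsilon+v(a,\mu_X(a))-\ell(a,\mu_X(a))\qquad(a\in\mathcal A_t).$$ For all unstructured utilities $u$, all arrival sequences $(\mathcal A_t)$ and all noise as above, with $n=\max_{t\le T}|\mathcal A_t|$, 1. the revenue is, surely, at least $\displaystyle \epsilon\sum_{t=1}^T|\mathcal A_t|-K\,|\mathcal A|\sqrt{nT}\,\sqrt{\log(|\mathcal A|T)}$ (the last term being read as $0$ if $|\mathcal A|T=0$), and 2. $\mathbb P\bigl[(X^t,\tau^t)\text{ is }\epsilon\text{-stable for all }1\le t\le T\bigr]\ge 0.99$. -/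

import Mathlib

open MeasureTheory ProbabilityTheory

noncomputable section

namespace MatchingMarket

/-- The agents on the platform: customers `C` and providers `P`. -/
abbrev Agent (C P : Type*) := C ⊕ P

/-- `X` is a matching between the customers and the providers in the set `A`:
a set of pairwise disjoint customer-provider pairs, all of whose members lie in `A`. -/
def IsMatching {C P : Type*} (A : Finset (Agent C P)) (X : Finset (C × P)) : Prop :=
  (∀ e ∈ X, (Sum.inl e.1 : Agent C P) ∈ A ∧ (Sum.inr e.2 : Agent C P) ∈ A) ∧
  (∀ e ∈ X, ∀ f ∈ X, e.1 = f.1 → e = f) ∧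
  (∀ e ∈ X, ∀ f ∈ X, e.2 = f.2 → e = f)

open Classical in
/-- The functional form of a matching: the partner of a matched agent; an unmatched agent is
sent to itself. -/
def partner {C P : Type*} (X : Finset (C × P)) : Agent C P → Agent C P
  | Sum.inl c => if h : ∃ p, (c, p) ∈ X then Sum.inr h.choose else Sum.inl c
  | Sum.inr p => if h : ∃ c, (c, p) ∈ X then Sum.inl h.choose else Sum.inr p

/-- A market outcome: a matching, and for every agent the amount of money which the platform
transfers to that agent (negative when the agent is charged). -/
structure MarketOutcome (C P : Type*) where
  matching : Finset (C × P)
  transfer : Agent C P → ℝ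

/-- The outcome concerns the market `A` only: it matches agents of `A`, and no money is
transferred to or from an agent outside `A`. -/
def IsOutcomeOn {C P : Type*} (A : Finset (Agent C P)) (o : MarketOutcome C P) : Prop :=
  IsMatching A o.matching ∧ ∀ a, a ∉ A → o.transfer a = 0

/-- Zero-sum transfers: the transfers of matched partners cancel, unmatched agents get zero. -/
def IsZeroSum {C P : Type*} (A : Finset (Agent C P)) (o : MarketOutcome C P) : Prop :=
  (∀ e ∈ o.matching, o.transfer (Sum.inl e.1) + o.transfer (Sum.inr e.2) = 0) ∧
  (∀ a ∈ A, partner o.matching a = a → o.transfer a = 0)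

/-- The net utility which `a` derives from the outcome `o` under the utilities `u`. -/
def netUtility {C P : Type*} (u : Agent C P → Agent C P → ℝ) (o : MarketOutcome C P)
    (a : Agent C P) : ℝ :=
  u a (partner o.matching a) + o.transfer a

/-- Stability of an outcome in the market `A`: individual rationality and no blocking pairs. -/
def IsStable {C P : Type*} (u : Agent C P → Agent C P → ℝ) (A : Finset (Agent C P))
    (o : MarketOutcome C P) : Prop :=
  (∀ a ∈ A, 0 ≤ netUtility u o a) ∧
  (∀ c p, (Sum.inl c : Agent C P) ∈ A → (Sum.inr p : Agent C P) ∈ A →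
    u (Sum.inl c) (Sum.inr p) + u (Sum.inr p) (Sum.inl c) ≤
      netUtility u o (Sum.inl c) + netUtility u o (Sum.inr p))

/-- `ε`-stability of an outcome in the market `A`: an agent loses `ε` utility when it leaves
the outcome. -/
def IsEpsStable {C P : Type*} (u : Agent C P → Agent C P → ℝ) (ε : ℝ)
    (A : Finset (Agent C P)) (o : MarketOutcome C P) : Prop :=
  (∀ a ∈ A, -ε ≤ netUtility u o a) ∧
  (∀ c p, (Sum.inl c : Agent C P) ∈ A → (Sum.inr p : Agent C P) ∈ A →
    u (Sum.inl c) (Sum.inr p) + u (Sum.inr p) (Sum.inl c) - 2 * ε ≤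
      netUtility u o (Sum.inl c) + netUtility u o (Sum.inr p))

/-- The unstructured preference class: all utilities lie in `[-1, 1]`. By convention an agent
has utility `0` for itself (being unmatched) and for agents of its own side. -/
def IsUnstructured {C P : Type*} (u : Agent C P → Agent C P → ℝ) : Prop :=
  (∀ a b, u a b ∈ Set.Icc (-1 : ℝ) 1) ∧
  (∀ c c', u (Sum.inl c) (Sum.inl c') = 0) ∧ (∀ p p', u (Sum.inr p) (Sum.inr p') = 0)

/-- What the platform has seen of a past round: who arrived, whom it matched, and the noisy
utilities which the arrived agents reported. -/
structure Round (C P : Type*) where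
  arrivals : Finset (Agent C P)
  matching : Finset (C × P)
  feedback : Agent C P → ℝ

/-- A learning algorithm of the platform: in round `t` (rounds are numbered from `0`) it
selects an outcome on the set `A` of arrived agents as a function of what it has seen in the
earlier rounds and of `A`. The choice depends measurably on the feedback. -/
structure Policy (C P : Type*) where
  choose : (t : ℕ) → (Fin t → Round C P) → Finset (Agent C P) → MarketOutcome C P
  isOutcomeOn : ∀ t h A, IsOutcomeOn A (choose t h A)
  measurable_matching : ∀ (t : ℕ) (As : Fin t → Finset (Agent C P))
    (Xs : Fin t → Finset (C × P)) (A : Finset (Agent C P)) (X : Finset (C × P)),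
    MeasurableSet {Y : Fin t → Agent C P → ℝ |
      (choose t (fun s => ⟨As s, Xs s, Y s⟩) A).matching = X}
  measurable_transfer : ∀ (t : ℕ) (As : Fin t → Finset (Agent C P))
    (Xs : Fin t → Finset (C × P)) (A : Finset (Agent C P)) (a : Agent C P),
    Measurable fun Y : Fin t → Agent C P → ℝ =>
      (choose t (fun s => ⟨As s, Xs s, Y s⟩) A).transfer a

open Classical in
/-- The outcome selected in round `t` when the algorithm `π` runs against the utilities `u`,
the arrivals `A` and the realized noise `z`: after round `s`, each agent `a` that arrived in it
reports its utility for its partner plus `z s a`. -/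
def Policy.play {C P : Type*} (π : Policy C P) (u : Agent C P → Agent C P → ℝ)
    (A : ℕ → Finset (Agent C P)) (z : ℕ → Agent C P → ℝ) (t : ℕ) : MarketOutcome C P :=
  π.choose t
    (fun s : Fin t =>
      { arrivals := A s
        matching := (π.play u A z s).matching
        feedback := fun a =>
          if a ∈ A s then u a (partner (π.play u A z s).matching a) + z s a else 0 })
    (A t)
termination_by t
decreasing_by all_goals exact s.isLt

/-- The net profit of the platform over the first `T` rounds. -/
def Policy.revenue {C P : Type*} (π : Policy C P) (u : Agent C P → Agent C P → ℝ)
    (A : ℕ → Finset (Agent C P)) (z : ℕ → Agent C P → ℝ) (T : ℕ) : ℝ :=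
  -∑ t ∈ Finset.range T, ∑ a ∈ A t, (π.play u A z t).transfer a

/-- The largest number of agents which arrive in one of the first `T` rounds. -/
def maxArrivals {C P : Type*} (A : ℕ → Finset (Agent C P)) (T : ℕ) : ℕ :=
  (Finset.range T).sup fun t => (A t).card

open Classical in
/-- The past rounds in which `a` was matched with `b`. -/
def matchedRounds {C P : Type*} {t : ℕ} (h : Fin t → Round C P) (a b : Agent C P) :
    Finset (Fin t) :=
  Finset.univ.filter fun s => partner (h s).matching a = b

/-- The empirical mean of the utility of `a` for `b`. -/
def empMean {C P : Type*} {t : ℕ} (h : Fin t → Round C P) (a b : Agent C P) : ℝ :=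
  (∑ s ∈ matchedRounds h a b, (h s).feedback a) / ((matchedRounds h a b).card : ℝ)

/-- Half the width, before clipping, of the confidence interval for the utility of `a` for `b`
when the horizon is `T`. -/
def radius {C P : Type*} [Fintype C] [Fintype P] (T : ℕ) {t : ℕ} (h : Fin t → Round C P)
    (a b : Agent C P) : ℝ :=
  8 * √(Real.log ((Fintype.card (Agent C P) : ℝ) * (T : ℝ)) / ((matchedRounds h a b).card : ℝ))

/-- The point of `[-1, 1]` nearest to `x`. -/
def clip (x : ℝ) : ℝ := max (-1) (min 1 x)

/-- The upper end of the confidence interval for the utility of `a` for `b`. It is `1` for a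
customer-provider pair that has not been matched yet, and `0` for two agents of the same side,
where the utility is known to be `0`. -/
def ucb {C P : Type*} [Fintype C] [Fintype P] (T : ℕ) {t : ℕ} (h : Fin t → Round C P)
    (a b : Agent C P) : ℝ :=
  if a.isLeft = b.isLeft then 0
  else if (matchedRounds h a b).card = 0 then 1
  else clip (empMean h a b + radius T h a b)

/-- The lower end of the confidence interval for the utility of `a` for `b`. -/
def lcb {C P : Type*} [Fintype C] [Fintype P] (T : ℕ) {t : ℕ} (h : Fin t → Round C P)
    (a b : Agent C P) : ℝ :=
  if a.isLeft = b.isLeft then 0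
  else if (matchedRounds h a b).card = 0 then -1
  else clip (empMean h a b - radius T h a b)

/-- `π` is a UCB algorithm for horizon `T` with search frictions `ε`: in each round it takes an
outcome with zero-sum transfers `τ` which is stable for the upper confidence bounds, keeps its
matching, and sets the transfer of each arrived agent to `τ a`, minus `ε`, plus the width of the
confidence interval for the utility of `a` for its partner. -/
def IsFrictionUCB {C P : Type*} [Fintype C] [Fintype P] (T : ℕ) (ε : ℝ) (π : Policy C P) :
    Prop :=
  ∀ (t : ℕ) (h : Fin t → Round C P) (A : Finset (Agent C P)),
    ∃ τ : Agent C P → ℝ,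
      IsZeroSum A ⟨(π.choose t h A).matching, τ⟩ ∧
      IsStable (ucb T h) A ⟨(π.choose t h A).matching, τ⟩ ∧
      ∀ a ∈ A, (π.choose t h A).transfer a = τ a - ε +
        (ucb T h a (partner (π.choose t h A).matching a) -
          lcb T h a (partner (π.choose t h A).matching a))

end MatchingMarket

end

/-! The algorithm selects a matching of largest total upper confidence bound, with transfers from an
optimal dual solution of the assignment problem (Shapley-Shubik). Optimality means that no
permutation of the agents lowers the reassignment cost. By Birkhoff's theorem no circulation then
has negative cost, so least walk costs are finite and form a potential, which gives the dual
variables (`potential_le_add`, `IsOptimalMatching.assignmentUtility_le`). Both the optimality of a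
given matching and a countable infimum of walk costs depend measurably on the feedback, and hence so
does the outcome.

Revenue: the zero-sum part cancels, so the loss against `ε` per arrival is the total width of the
confidence intervals of matched pairs. With `L = √(log(|𝒜|T))`, a pair matched `m ≥ 1` times before
has width at most `16L/√m`. Summing over time gives `48L√N` for a pair matched `N` times, and
Cauchy-Schwarz over at most `|𝒜|²` ordered pairs, whose counts add up to at most `nT`, gives the
bound (`IsFrictionUCB.le_revenue`).

Stability: when all intervals contain the true utilities, the added width makes up for the optimism
of the upper bounds, so that stability for `v` becomes `ε`-stability for `u`
(`isEpsStable_of_confidence`). The intervals may fail because the matchings depend on past noise. An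
exponential supermartingale handles this dependence, and a union bound over pairs, rounds and counts
finishes (`measureReal_failureEvent_le`). -/

namespace MatchingMarket

/-! ### Potentials for costs without negative circulations. -/

section Potential

variable {V : Type*}

/-- The cost of walking along the vertices of a list, from its last to its first member, and then
to the vertex `j`, when a step from `i` to `j` costs `d i j`. -/
def pathCost (d : V → V → ℝ) : List V → V → ℝ
  | [], _ => 0
  | i :: l, j => pathCost d l i + d i j

/-- The least cost of a walk which ends in `j`. -/
noncomputable def potential (d : V → V → ℝ) (j : V) : ℝ := ⨅ l : List V, pathCost d l j

/-- Scaled down and completed on the diagonal, which costs nothing, a circulation becomes a doubly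
stochastic matrix. By Birkhoff's theorem this is a convex combination of permutation matrices. -/
theorem sum_mul_nonneg_of_circulation [Fintype V] [DecidableEq V] {d : V → V → ℝ}
    (hd : ∀ σ : Equiv.Perm V, 0 ≤ ∑ i, d i (σ i)) (hdiag : ∀ i, d i i = 0) {N : V → V → ℝ}
    (hN : ∀ i j, 0 ≤ N i j) (hbal : ∀ i, ∑ j, N i j = ∑ j, N j i) :
    0 ≤ ∑ i, ∑ j, N i j * d i j := by
  -- The total flow bounds every row sum, so the diagonal completion is nonnegative; the extra `1`
  -- makes `r` positive.
  set r : ℝ := 1 + ∑ i, ∑ j, N i j with hr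
  have hrow : ∀ i, ∑ j, N i j ≤ ∑ i, ∑ j, N i j := fun i =>
    Finset.single_le_sum (f := fun i => ∑ j, N i j)
      (fun i _ => Finset.sum_nonneg fun j _ => hN i j) (Finset.mem_univ i)
  have hr0 : 0 < r := by
    have : 0 ≤ ∑ i, ∑ j, N i j := Finset.sum_nonneg fun i _ => Finset.sum_nonneg fun j _ => hN i j
    linarith
  let D : Matrix V V ℝ := fun i j => (N i j + if i = j then r - ∑ k, N i k else 0) / r
  have hD : D ∈ doublyStochastic ℝ V := by
    rw [mem_doublyStochastic_iff_sum]
    refine ⟨fun i j => ?_, fun i => ?_, fun j => ?_⟩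
    · refine div_nonneg (add_nonneg (hN i j) ?_) hr0.le
      split_ifs
      · linarith [hrow i]
      · exact le_rfl
    · simp only [D, ← Finset.sum_div, Finset.sum_add_distrib, Finset.sum_ite_eq,
        Finset.mem_univ, if_true]
      rw [add_sub_cancel, div_self hr0.ne']
    · simp only [D, ← Finset.sum_div, Finset.sum_add_distrib, Finset.sum_ite_eq',
        Finset.mem_univ, if_true]
      rw [← hbal j, add_sub_cancel, div_self hr0.ne']
  obtain ⟨w, hw0, -, hw⟩ := exists_eq_sum_perm_of_mem_doublyStochastic hD
  have hcost : ∑ i, ∑ j, N i j * d i j = r * ∑ i, ∑ j, D i j * d i j := by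
    simp only [Finset.mul_sum]
    refine Finset.sum_congr rfl fun i _ => Finset.sum_congr rfl fun j _ => ?_
    simp only [D]
    split_ifs with hij
    · subst hij; simp [hdiag]
    · field_simp; ring
  have hperm : ∑ i, ∑ j, D i j * d i j = ∑ σ, w σ * ∑ i, d i (σ i) := by
    have hent : ∀ i j, D i j = ∑ σ, w σ * if σ i = j then 1 else 0 := fun i j => by
      rw [← hw, Matrix.sum_apply]
      refine Finset.sum_congr rfl fun σ _ => ?_
      simp [Equiv.Perm.permMatrix, PEquiv.toMatrix_apply, eq_comm]
    simp only [hent, Finset.sum_mul, Finset.mul_sum]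
    calc _ = ∑ i, ∑ σ, ∑ j, w σ * (if σ i = j then 1 else 0) * d i j :=
          Finset.sum_congr rfl fun i _ => Finset.sum_comm
      _ = ∑ σ, ∑ i, ∑ j, w σ * (if σ i = j then 1 else 0) * d i j := Finset.sum_comm
      _ = _ := by simp
  rw [hcost, hperm]
  exact mul_nonneg hr0.le (Finset.sum_nonneg fun σ _ => mul_nonneg (hw0 σ) (hd σ))

/-- `N` counts the traversals of each edge by the walk, and `s` is its starting vertex. Balance
fails only at the two ends. -/
theorem exists_flow_of_path [Fintype V] [DecidableEq V] (d : V → V → ℝ) (l : List V) (j : V) :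
    ∃ (N : V → V → ℝ) (s : V), (∀ a b, 0 ≤ N a b) ∧
      (∀ a, ∑ b, N a b + (if a = j then 1 else 0) = ∑ b, N b a + (if a = s then 1 else 0)) ∧
      pathCost d l j = ∑ a, ∑ b, N a b * d a b := by
  induction l generalizing j with
  | nil => exact ⟨fun _ _ => 0, j, by simp, by simp, by simp [pathCost]⟩
  | cons i l ih =>
    obtain ⟨N, s, h0, hbal, hc⟩ := ih i
    refine ⟨fun a b => N a b + if a = i then if b = j then 1 else 0 else 0, s, ?_, ?_, ?_⟩
    · intro a b
      have := h0 a b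
      dsimp only
      split_ifs <;> linarith
    · intro a
      have := hbal a
      have h1 : ∑ b, (if a = i then if b = j then (1 : ℝ) else 0 else 0) =
          if a = i then 1 else 0 := by split_ifs <;> simp
      have h2 : ∑ b, (if b = i then if a = j then (1 : ℝ) else 0 else 0) =
          if a = j then 1 else 0 := by simp
      rw [Finset.sum_add_distrib, Finset.sum_add_distrib, h1, h2]
      linarith
    · simp [pathCost, hc, add_mul, Finset.sum_add_distrib]

/-- The edge from `j` back to the start `s` closes a walk to a circulation, so the walk costs at
least `-d j s`. The sum over all `s` makes the bound independent of the walk. -/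
theorem bddBelow_pathCost [Fintype V] {d : V → V → ℝ}
    (hd : ∀ σ : Equiv.Perm V, 0 ≤ ∑ i, d i (σ i)) (hdiag : ∀ i, d i i = 0) (j : V) :
    BddBelow (Set.range fun l => pathCost d l j) := by
  classical
  refine ⟨-∑ s, |d j s|, ?_⟩
  rintro _ ⟨l, rfl⟩
  obtain ⟨N, s, h0, hbal, hc⟩ := exists_flow_of_path d l j
  have key := sum_mul_nonneg_of_circulation hd hdiag
    (N := fun a b => N a b + if a = j then if b = s then 1 else 0 else 0) (by
      intro a b
      have := h0 a b
      split_ifs <;> linarith) (by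
      intro a
      have h1 : ∑ b, (if a = j then if b = s then (1 : ℝ) else 0 else 0) =
          if a = j then 1 else 0 := by split_ifs <;> simp
      have h2 : ∑ b, (if b = j then if a = s then (1 : ℝ) else 0 else 0) =
          if a = s then 1 else 0 := by simp
      rw [Finset.sum_add_distrib, Finset.sum_add_distrib, h1, h2]
      exact hbal a)
  have hsum : pathCost d l j + d j s =
      ∑ a, ∑ b, (N a b + if a = j then if b = s then 1 else 0 else 0) * d a b := by
    simp [hc, add_mul, Finset.sum_add_distrib]
  have := Finset.single_le_sum (f := fun s => |d j s|) (fun s _ => abs_nonneg _)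
    (Finset.mem_univ s)
  have := le_abs_self (d j s)
  simp only at *
  linarith

theorem potential_le_add [Fintype V] {d : V → V → ℝ}
    (hd : ∀ σ : Equiv.Perm V, 0 ≤ ∑ i, d i (σ i)) (hdiag : ∀ i, d i i = 0) (i j : V) :
    potential d j ≤ potential d i + d i j := by
  rw [← sub_le_iff_le_add]
  refine le_ciInf fun l => ?_
  rw [sub_le_iff_le_add]
  exact ciInf_le (bddBelow_pathCost hd hdiag j) (i :: l)

theorem measurable_potential [Countable V] {Ω : Type*} [MeasurableSpace Ω] {d : Ω → V → V → ℝ}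
    (hd : ∀ i j, Measurable fun ω => d ω i j) (j : V) :
    Measurable fun ω => potential (d ω) j := by
  refine Measurable.iInf fun l => ?_
  induction l generalizing j with
  | nil => exact measurable_const
  | cons i l ih => exact (ih i).add (hd i j)

end Potential

/-! ### The partner map of a matching. -/

section Partner

variable {C P : Type*} {A : Finset (Agent C P)} {X : Finset (C × P)}

theorem IsMatching.partner_inl (hX : IsMatching A X) {c : C} {p : P} (h : (c, p) ∈ X) :
    partner X (Sum.inl c) = Sum.inr p := by
  have hex : ∃ p, (c, p) ∈ X := ⟨p, h⟩
  simp only [partner, hex, dif_pos]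
  exact congrArg (fun e => Sum.inr e.2) (hX.2.1 _ hex.choose_spec _ h rfl)

theorem IsMatching.partner_inr (hX : IsMatching A X) {c : C} {p : P} (h : (c, p) ∈ X) :
    partner X (Sum.inr p) = Sum.inl c := by
  have hex : ∃ c, (c, p) ∈ X := ⟨c, h⟩
  simp only [partner, hex, dif_pos]
  exact congrArg (fun e => Sum.inl e.1) (hX.2.2 _ hex.choose_spec _ h rfl)

theorem partner_inl_eq_inr {c : C} {p : P} (h : partner X (Sum.inl c) = Sum.inr p) :
    (c, p) ∈ X := by
  simp only [partner] at h
  split_ifs at h with hex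
  exact Sum.inr_injective h ▸ hex.choose_spec

theorem partner_inr_eq_inl {c : C} {p : P} (h : partner X (Sum.inr p) = Sum.inl c) :
    (c, p) ∈ X := by
  simp only [partner] at h
  split_ifs at h with hex
  exact Sum.inl_injective h ▸ hex.choose_spec

theorem eq_of_partner_inl_eq_inl {c c' : C} (h : partner X (Sum.inl c : Agent C P) = Sum.inl c') :
    c' = c := by
  simp only [partner] at h
  split_ifs at h with hex
  exact (Sum.inl_injective h).symm

theorem eq_of_partner_inr_eq_inr {p p' : P} (h : partner X (Sum.inr p : Agent C P) = Sum.inr p') :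
    p' = p := by
  simp only [partner] at h
  split_ifs at h with hex
  exact (Sum.inr_injective h).symm

theorem IsMatching.partner_inl_iff (hX : IsMatching A X) {c : C} {p : P} :
    partner X (Sum.inl c) = Sum.inr p ↔ (c, p) ∈ X :=
  ⟨partner_inl_eq_inr, hX.partner_inl⟩

theorem IsMatching.partner_involutive (hX : IsMatching A X) : Function.Involutive (partner X) := by
  rintro (c | p)
  · rcases h : partner X (Sum.inl c : Agent C P) with c' | p
    · obtain rfl := eq_of_partner_inl_eq_inl h; exact h
    · exact hX.partner_inr (partner_inl_eq_inr h)
  · rcases h : partner X (Sum.inr p : Agent C P) with c | p'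
    · exact hX.partner_inl (partner_inr_eq_inl h)
    · obtain rfl := eq_of_partner_inr_eq_inr h; exact h

/-- An agent is unmatched, or it has an arrived partner of the other side. -/
theorem IsMatching.partner_eq_self_or (hX : IsMatching A X) (a : Agent C P) :
    partner X a = a ∨ (a ∈ A ∧ partner X a ∈ A ∧ a.isLeft ≠ (partner X a).isLeft) := by
  rcases a with c | p
  · rcases h : partner X (Sum.inl c : Agent C P) with c' | p
    · exact .inl (by rw [eq_of_partner_inl_eq_inl h])
    · have := hX.1 _ (partner_inl_eq_inr h)
      exact .inr ⟨this.1, this.2, by simp⟩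
  · rcases h : partner X (Sum.inr p : Agent C P) with c | p'
    · have := hX.1 _ (partner_inr_eq_inl h)
      exact .inr ⟨this.2, this.1, by simp⟩
    · exact .inl (by rw [eq_of_partner_inr_eq_inr h])

theorem IsMatching.partner_mem (hX : IsMatching A X) {a : Agent C P} (ha : a ∈ A) :
    partner X a ∈ A := by
  rcases hX.partner_eq_self_or a with h | h
  · rwa [h]
  · exact h.2.1

theorem isMatching_empty (A : Finset (Agent C P)) : IsMatching A (∅ : Finset (C × P)) := by
  simp [IsMatching]

end Partner

/-! ### Stable outcomes from optimal assignments. -/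

section StableOutcome

variable {C P : Type*}

/-- The total utility of a customer-provider pair. -/
def pairUtility (w : Agent C P → Agent C P → ℝ) (c : C) (p : P) : ℝ :=
  w (Sum.inl c) (Sum.inr p) + w (Sum.inr p) (Sum.inl c)

/-- The total utility of the matched pairs. -/
noncomputable def welfare (w : Agent C P → Agent C P → ℝ) (X : Finset (C × P)) : ℝ :=
  ∑ e ∈ X, pairUtility w e.1 e.2

open Classical in
/-- The utility matrix of the assignment problem with the agents as rows and as columns: the
entry of an arrived customer and an arrived provider is their total utility, all others are
zero. -/
noncomputable def assignmentUtility (A : Finset (Agent C P)) (w : Agent C P → Agent C P → ℝ) :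
    Agent C P → Agent C P → ℝ
  | Sum.inl c, Sum.inr p =>
    if (Sum.inl c : Agent C P) ∈ A ∧ (Sum.inr p : Agent C P) ∈ A then pairUtility w c p else 0
  | _, _ => 0

/-- The loss of row `a` when it is moved from the column of its partner in `X` to that of the
partner of `b`. -/
noncomputable def reassignmentCost (A : Finset (Agent C P)) (w : Agent C P → Agent C P → ℝ)
    (X : Finset (C × P)) (a b : Agent C P) : ℝ :=
  assignmentUtility A w a (partner X a) - assignmentUtility A w a (partner X b)

/-- Net utilities which support an optimal matching `X`. -/
noncomputable def corePayoff (A : Finset (Agent C P)) (w : Agent C P → Agent C P → ℝ)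
    (X : Finset (C × P)) (a : Agent C P) : ℝ :=
  assignmentUtility A w a (partner X a) + potential (reassignmentCost A w X) a -
    potential (reassignmentCost A w X) (partner X a)

/-- The transfers which turn `X` into an outcome with the net utilities `corePayoff`. -/
noncomputable def coreTransfer (A : Finset (Agent C P)) (w : Agent C P → Agent C P → ℝ)
    (X : Finset (C × P)) (a : Agent C P) : ℝ :=
  corePayoff A w X a - w a (partner X a)

/-- `X` has the largest total utility among the matchings on `A`. -/
def IsOptimalMatching (A : Finset (Agent C P)) (w : Agent C P → Agent C P → ℝ)
    (X : Finset (C × P)) : Prop :=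
  IsMatching A X ∧ ∀ Y, IsMatching A Y → welfare w Y ≤ welfare w X

variable [Fintype C] [Fintype P] {A : Finset (Agent C P)} {w : Agent C P → Agent C P → ℝ}
  {X : Finset (C × P)}

open Classical in
/-- The pairs of arrived agents which a permutation of the agents assigns to each other. -/
noncomputable def assignedPairs (A : Finset (Agent C P)) (f : Agent C P → Agent C P) :
    Finset (C × P) :=
  Finset.univ.filter fun e => (Sum.inl e.1 : Agent C P) ∈ A ∧ (Sum.inr e.2 : Agent C P) ∈ A ∧
    f (Sum.inl e.1) = Sum.inr e.2

theorem isMatching_assignedPairs {f : Agent C P → Agent C P} (hf : Function.Injective f) :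
    IsMatching A (assignedPairs A f) := by
  simp only [IsMatching, assignedPairs, Finset.mem_filter, Finset.mem_univ, true_and]
  refine ⟨fun e he => ⟨he.1, he.2.1⟩, fun e he e' he' h => ?_, fun e he e' he' h => ?_⟩
  · exact Prod.ext h (Sum.inr_injective (he.2.2.symm.trans (h ▸ he'.2.2)))
  · exact Prod.ext (Sum.inl_injective (hf (he.2.2.trans (h ▸ he'.2.2.symm)))) h

theorem IsMatching.assignedPairs_partner (hX : IsMatching A X) :
    assignedPairs A (partner X) = X := by
  ext ⟨c, p⟩
  simp only [assignedPairs, Finset.mem_filter, Finset.mem_univ, true_and, hX.partner_inl_iff]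
  exact ⟨fun h => h.2.2, fun h => ⟨(hX.1 _ h).1, (hX.1 _ h).2, h⟩⟩

theorem sum_assignmentUtility (f : Agent C P → Agent C P) :
    ∑ a, assignmentUtility A w a (f a) = welfare w (assignedPairs A f) := by
  classical
  rw [Fintype.sum_sum_type, welfare, assignedPairs, Finset.sum_filter, Fintype.sum_prod_type]
  simp only [assignmentUtility, Finset.sum_const_zero, add_zero]
  refine Finset.sum_congr rfl fun c _ => ?_
  rcases h : f (Sum.inl c) with c' | p
  · simp
  · rw [Finset.sum_eq_single p]
    · simp
    · intro q _ hq
      simp [hq.symm]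
    · simp

theorem IsOptimalMatching.sum_reassignmentCost_nonneg (hX : IsOptimalMatching A w X)
    (σ : Equiv.Perm (Agent C P)) : 0 ≤ ∑ a, reassignmentCost A w X a (σ a) := by
  simp only [reassignmentCost]
  rw [Finset.sum_sub_distrib, sum_assignmentUtility (partner X),
    sum_assignmentUtility (fun a => partner X (σ a)), hX.1.assignedPairs_partner, sub_nonneg]
  exact hX.2 _ (isMatching_assignedPairs (hX.1.partner_involutive.injective.comp σ.injective))

/-- This is dual feasibility: row `a` has the dual variable `assignmentUtility A w a (partner X a)`
plus its potential, and column `b` has minus the potential of `partner X b`. `corePayoff` adds the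
two duals of an agent, who is both a row and a column. -/
theorem IsOptimalMatching.assignmentUtility_le (hX : IsOptimalMatching A w X) (a b : Agent C P) :
    assignmentUtility A w a b ≤ assignmentUtility A w a (partner X a) +
      potential (reassignmentCost A w X) a - potential (reassignmentCost A w X) (partner X b) := by
  have := potential_le_add hX.sum_reassignmentCost_nonneg (fun i => sub_self _) a (partner X b)
  rw [reassignmentCost, hX.1.partner_involutive b] at this
  linarith

omit [Fintype C] [Fintype P] in
theorem assignmentUtility_self (a : Agent C P) : assignmentUtility A w a a = 0 := by
  cases a <;> rfl

/-- Individual rationality is dual feasibility at the diagonal entry, which is zero. -/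
theorem IsOptimalMatching.corePayoff_nonneg (hX : IsOptimalMatching A w X) (a : Agent C P) :
    0 ≤ corePayoff A w X a :=
  (assignmentUtility_self (A := A) (w := w) a).ge.trans (hX.assignmentUtility_le a a)

theorem IsOptimalMatching.pairUtility_le (hX : IsOptimalMatching A w X) {c : C} {p : P}
    (hc : (Sum.inl c : Agent C P) ∈ A) (hp : (Sum.inr p : Agent C P) ∈ A) :
    pairUtility w c p ≤ corePayoff A w X (Sum.inl c) + corePayoff A w X (Sum.inr p) := by
  have h1 := hX.assignmentUtility_le (Sum.inl c) (Sum.inr p)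
  -- The entry in row `p` and column `c` is zero; adding its constraint brings in the remaining dual
  -- variable of each agent.
  have h2 := hX.assignmentUtility_le (Sum.inr p) (Sum.inl c)
  have h3 : assignmentUtility A w (Sum.inl c) (Sum.inr p) = pairUtility w c p := by
    simp [assignmentUtility, hc, hp]
  have h4 : assignmentUtility A w (Sum.inr p) (Sum.inl c) = 0 := rfl
  simp only [corePayoff]
  linarith

omit [Fintype C] [Fintype P] in
theorem IsOptimalMatching.corePayoff_add (hX : IsOptimalMatching A w X) {c : C} {p : P}
    (h : (c, p) ∈ X) :
    corePayoff A w X (Sum.inl c) + corePayoff A w X (Sum.inr p) = pairUtility w c p := by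
  simp only [corePayoff, hX.1.partner_inl h, hX.1.partner_inr h]
  simp [assignmentUtility, hX.1.1 _ h]

omit [Fintype C] [Fintype P] in
theorem corePayoff_of_unmatched {a : Agent C P} (h : partner X a = a) :
    corePayoff A w X a = 0 := by
  simp [corePayoff, h, assignmentUtility_self]

theorem IsOptimalMatching.isStable (hX : IsOptimalMatching A w X) :
    IsStable w A ⟨X, coreTransfer A w X⟩ := by
  simp only [IsStable, netUtility, coreTransfer, add_sub_cancel]
  exact ⟨fun a _ => hX.corePayoff_nonneg a, fun c p hc hp => hX.pairUtility_le hc hp⟩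

omit [Fintype C] [Fintype P] in
theorem IsOptimalMatching.isZeroSum (hX : IsOptimalMatching A w X) (hw : ∀ a, w a a = 0) :
    IsZeroSum A ⟨X, coreTransfer A w X⟩ := by
  refine ⟨fun ⟨c, p⟩ he => ?_, fun a _ ha => ?_⟩
  · have := hX.corePayoff_add he
    simp only [coreTransfer, hX.1.partner_inl he, hX.1.partner_inr he, pairUtility] at this ⊢
    linarith
  · dsimp only at ha ⊢
    rw [coreTransfer, corePayoff_of_unmatched ha, ha, hw, sub_zero]

open Classical in
/-- The matchings of largest total utility. -/
noncomputable def optimalMatchings (A : Finset (Agent C P)) (w : Agent C P → Agent C P → ℝ) :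
    Finset (Finset (C × P)) :=
  Finset.univ.filter (IsOptimalMatching A w)

theorem optimalMatchings_nonempty (A : Finset (Agent C P)) (w : Agent C P → Agent C P → ℝ) :
    (optimalMatchings A w).Nonempty := by
  classical
  obtain ⟨X, hX, hmax⟩ := Finset.exists_max_image
    (Finset.univ.filter fun X : Finset (C × P) => IsMatching A X) (welfare w)
    ⟨∅, by simpa using isMatching_empty A⟩
  simp only [Finset.mem_filter, Finset.mem_univ, true_and] at hX hmax
  exact ⟨X, by simpa [optimalMatchings] using ⟨hX, hmax⟩⟩

open Classical in
/-- A member of a set of matchings, which only depends on the set. -/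
noncomputable def selectMatching (S : Finset (Finset (C × P))) : Finset (C × P) :=
  if h : S.Nonempty then h.choose else ∅

/-- A matching of largest total utility. -/
noncomputable def optimalMatching (A : Finset (Agent C P)) (w : Agent C P → Agent C P → ℝ) :
    Finset (C × P) :=
  selectMatching (optimalMatchings A w)

theorem isOptimalMatching_optimalMatching (A : Finset (Agent C P))
    (w : Agent C P → Agent C P → ℝ) : IsOptimalMatching A w (optimalMatching A w) := by
  have h := optimalMatchings_nonempty A w
  have := h.choose_spec
  simp only [optimalMatchings, Finset.mem_filter, Finset.mem_univ, true_and] at this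
  rw [optimalMatching, selectMatching, dif_pos h]
  exact this

section Measurability

variable {Ω : Type*} [MeasurableSpace Ω] {w : Ω → Agent C P → Agent C P → ℝ}

omit [Fintype C] [Fintype P] in
theorem measurable_welfare (hw : ∀ a b, Measurable fun ω => w ω a b) (X : Finset (C × P)) :
    Measurable fun ω => welfare (w ω) X :=
  Finset.measurable_fun_sum _ fun _ _ => (hw _ _).add (hw _ _)

theorem measurableSet_isOptimalMatching (hw : ∀ a b, Measurable fun ω => w ω a b)
    (A : Finset (Agent C P)) (X : Finset (C × P)) :
    MeasurableSet {ω | IsOptimalMatching A (w ω) X} := by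
  simp only [IsOptimalMatching, Set.ofPred_and, Set.ofPred_forall]
  exact (MeasurableSet.const _).inter (MeasurableSet.iInter fun Y => MeasurableSet.iInter fun _ =>
    measurableSet_le (measurable_welfare hw Y) (measurable_welfare hw X))

/-- The selection depends only on the finite set of optimal matchings, and this set is determined by
finitely many inequalities between welfares. -/
theorem measurableSet_optimalMatching_eq (hw : ∀ a b, Measurable fun ω => w ω a b)
    (A : Finset (Agent C P)) (X : Finset (C × P)) :
    MeasurableSet {ω | optimalMatching A (w ω) = X} := by
  have hS : ∀ S, MeasurableSet {ω | optimalMatchings A (w ω) = S} := fun S => by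
    simp only [Finset.ext_iff, optimalMatchings, Finset.mem_filter, Finset.mem_univ, true_and,
      Set.ofPred_forall]
    refine MeasurableSet.iInter fun Y => ?_
    by_cases hY : Y ∈ S
    · simp only [hY, iff_true]
      exact measurableSet_isOptimalMatching hw A Y
    · simp only [hY, iff_false]
      exact (measurableSet_isOptimalMatching hw A Y).compl
  have : {ω | optimalMatching A (w ω) = X} =
      ⋃ S ∈ {S | selectMatching S = X}, {ω | optimalMatchings A (w ω) = S} := by
    ext ω; simp [optimalMatching]
  rw [this]
  exact MeasurableSet.biUnion (Set.to_countable _) fun S _ => hS S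

omit [Fintype C] [Fintype P] in
theorem measurable_assignmentUtility (hw : ∀ a b, Measurable fun ω => w ω a b)
    (A : Finset (Agent C P)) (a b : Agent C P) :
    Measurable fun ω => assignmentUtility A (w ω) a b := by
  rcases a with c | p <;> rcases b with c' | p' <;> simp only [assignmentUtility, pairUtility]
  any_goals exact measurable_const
  split_ifs
  exacts [(hw _ _).add (hw _ _), measurable_const]

theorem measurable_coreTransfer (hw : ∀ a b, Measurable fun ω => w ω a b)
    (A : Finset (Agent C P)) (X : Finset (C × P)) (a : Agent C P) :
    Measurable fun ω => coreTransfer A (w ω) X a := by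
  have hM := measurable_assignmentUtility hw A
  have hpot : ∀ a, Measurable fun ω => potential (reassignmentCost A (w ω) X) a :=
    measurable_potential fun i j => (hM _ _).sub (hM _ _)
  exact (((hM _ _).add (hpot _)).sub (hpot _)).sub (hw _ _)

end Measurability

end StableOutcome

/-! ### Measurability and construction of the algorithm. -/

section UCBPolicy

variable {C P : Type*} [Fintype C] [Fintype P]

theorem measurable_clip : Measurable clip :=
  measurable_const.max (measurable_const.min measurable_id)

omit [Fintype C] [Fintype P] in
-- Counts ignore the feedback, so once arrivals and matchings are fixed only the empirical mean
-- varies.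
theorem matchedRounds_eq {t : ℕ} (As : Fin t → Finset (Agent C P)) (Xs : Fin t → Finset (C × P))
    (Y : Fin t → Agent C P → ℝ) (a b : Agent C P) :
    matchedRounds (fun s => ⟨As s, Xs s, Y s⟩) a b =
      matchedRounds (fun s => ⟨As s, Xs s, 0⟩) a b :=
  rfl

omit [Fintype C] [Fintype P] in
theorem measurable_empMean {t : ℕ} (As : Fin t → Finset (Agent C P))
    (Xs : Fin t → Finset (C × P)) (a b : Agent C P) :
    Measurable fun Y : Fin t → Agent C P → ℝ => empMean (fun s => ⟨As s, Xs s, Y s⟩) a b := by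
  simp only [empMean, matchedRounds_eq As Xs]
  refine (Finset.measurable_fun_sum _ fun s _ => ?_).div_const _
  fun_prop

theorem measurable_ucb (T : ℕ) {t : ℕ} (As : Fin t → Finset (Agent C P))
    (Xs : Fin t → Finset (C × P)) (a b : Agent C P) :
    Measurable fun Y : Fin t → Agent C P → ℝ => ucb T (fun s => ⟨As s, Xs s, Y s⟩) a b := by
  have h := measurable_empMean As Xs a b
  simp only [ucb, radius, matchedRounds_eq As Xs]
  exact .ite (.const _) measurable_const (.ite (.const _) measurable_const
    (measurable_clip.comp (h.add_const _)))

theorem measurable_lcb (T : ℕ) {t : ℕ} (As : Fin t → Finset (Agent C P))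
    (Xs : Fin t → Finset (C × P)) (a b : Agent C P) :
    Measurable fun Y : Fin t → Agent C P → ℝ => lcb T (fun s => ⟨As s, Xs s, Y s⟩) a b := by
  have h := measurable_empMean As Xs a b
  simp only [lcb, radius, matchedRounds_eq As Xs]
  exact .ite (.const _) measurable_const (.ite (.const _) measurable_const
    (measurable_clip.comp (h.sub_const _)))

open Classical in
/-- The transfers of the UCB algorithm in the market `A`, when it selects the matching `X`. -/
noncomputable def frictionTransfer (T : ℕ) (ε : ℝ) {t : ℕ} (h : Fin t → Round C P)
    (A : Finset (Agent C P)) (X : Finset (C × P)) (a : Agent C P) : ℝ :=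
  if a ∈ A then coreTransfer A (ucb T h) X a - ε +
    (ucb T h a (partner X a) - lcb T h a (partner X a)) else 0

theorem measurable_frictionTransfer (T : ℕ) (ε : ℝ) {t : ℕ} (As : Fin t → Finset (Agent C P))
    (Xs : Fin t → Finset (C × P)) (A : Finset (Agent C P)) (X : Finset (C × P))
    (a : Agent C P) :
    Measurable fun Y : Fin t → Agent C P → ℝ =>
      frictionTransfer T ε (fun s => ⟨As s, Xs s, Y s⟩) A X a := by
  unfold frictionTransfer
  split_ifs
  · exact ((measurable_coreTransfer (measurable_ucb T As Xs) A X a).sub_const ε).add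
      ((measurable_ucb T As Xs _ _).sub (measurable_lcb T As Xs _ _))
  · exact measurable_const

theorem measurable_apply_of_countable {Ω ι β : Type*} [MeasurableSpace Ω] [MeasurableSpace β]
    [Countable ι] {X : Ω → ι} (hX : ∀ i, MeasurableSet {ω | X ω = i}) {f : ι → Ω → β}
    (hf : ∀ i, Measurable (f i)) : Measurable fun ω => f (X ω) ω := by
  intro B hB
  have : (fun ω => f (X ω) ω) ⁻¹' B = ⋃ i, {ω | X ω = i} ∩ f i ⁻¹' B := by
    ext ω; simp
  rw [this]
  exact MeasurableSet.iUnion fun i => (hX i).inter (hf i hB)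

/-- The UCB algorithm with search frictions: the matching of largest total upper confidence
bound, with transfers derived from an optimal dual solution. -/
noncomputable def ucbPolicy (C P : Type*) [Fintype C] [Fintype P] (T : ℕ) (ε : ℝ) :
    Policy C P where
  choose _ h A := ⟨optimalMatching A (ucb T h),
    frictionTransfer T ε h A (optimalMatching A (ucb T h))⟩
  isOutcomeOn _ h A :=
    ⟨(isOptimalMatching_optimalMatching A (ucb T h)).1, fun _ ha => if_neg ha⟩
  measurable_matching _ As Xs A X :=
    measurableSet_optimalMatching_eq (measurable_ucb T As Xs) A X
  measurable_transfer _ As Xs A a :=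
    measurable_apply_of_countable
      (measurableSet_optimalMatching_eq (measurable_ucb T As Xs) A)
      (fun X => measurable_frictionTransfer T ε As Xs A X a)

theorem ucb_self (T : ℕ) {t : ℕ} (h : Fin t → Round C P) (a : Agent C P) : ucb T h a a = 0 :=
  if_pos rfl

theorem lcb_self (T : ℕ) {t : ℕ} (h : Fin t → Round C P) (a : Agent C P) : lcb T h a a = 0 :=
  if_pos rfl

theorem isFrictionUCB_ucbPolicy (T : ℕ) (ε : ℝ) : IsFrictionUCB T ε (ucbPolicy C P T ε) := by
  intro t h A
  have hopt := isOptimalMatching_optimalMatching A (ucb T h)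
  exact ⟨coreTransfer A (ucb T h) (optimalMatching A (ucb T h)), hopt.isZeroSum (ucb_self T h),
    hopt.isStable, fun a ha => if_pos ha⟩

end UCBPolicy

/-! ### Histories and match counts of a run. -/

section Play

variable {C P : Type*} {π : Policy C P} {u : Agent C P → Agent C P → ℝ}
  {A : ℕ → Finset (Agent C P)} {z : ℕ → Agent C P → ℝ}

open Classical in
/-- What the platform has seen before round `t`. -/
noncomputable def history (π : Policy C P) (u : Agent C P → Agent C P → ℝ)
    (A : ℕ → Finset (Agent C P)) (z : ℕ → Agent C P → ℝ) (t : ℕ) : Fin t → Round C P :=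
  fun s =>
    { arrivals := A s
      matching := (π.play u A z s).matching
      feedback := fun a =>
        if a ∈ A s then u a (partner (π.play u A z s).matching a) + z s a else 0 }

theorem play_eq (t : ℕ) : π.play u A z t = π.choose t (history π u A z t) (A t) := by
  rw [Policy.play]
  rfl

theorem isMatching_play (π : Policy C P) (u : Agent C P → Agent C P → ℝ)
    (A : ℕ → Finset (Agent C P)) (z : ℕ → Agent C P → ℝ) (t : ℕ) :
    IsMatching (A t) (π.play u A z t).matching := by
  rw [play_eq]
  exact (π.isOutcomeOn _ _ _).1

open Classical in
/-- Whether `a` is matched with `b` in round `t`, as a number. -/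
noncomputable def matchIndicator (π : Policy C P) (u : Agent C P → Agent C P → ℝ)
    (A : ℕ → Finset (Agent C P)) (z : ℕ → Agent C P → ℝ) (a b : Agent C P) (t : ℕ) : ℕ :=
  if partner (π.play u A z t).matching a = b then 1 else 0

/-- The number of rounds before round `t` in which `a` was matched with `b`. -/
noncomputable def matchCount (π : Policy C P) (u : Agent C P → Agent C P → ℝ)
    (A : ℕ → Finset (Agent C P)) (z : ℕ → Agent C P → ℝ) (a b : Agent C P) (t : ℕ) : ℕ :=
  ∑ s ∈ Finset.range t, matchIndicator π u A z a b s

theorem card_matchedRounds_history (a b : Agent C P) (t : ℕ) :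
    (matchedRounds (history π u A z t) a b).card = matchCount π u A z a b t := by
  rw [matchCount, ← Fin.sum_univ_eq_sum_range, matchedRounds, Finset.card_filter]
  rfl

theorem matchCount_succ (a b : Agent C P) (t : ℕ) : matchCount π u A z a b (t + 1) =
    matchCount π u A z a b t + matchIndicator π u A z a b t :=
  Finset.sum_range_succ _ _

end Play

/-! ### The revenue bound. -/

section Revenue

variable {C P : Type*}

theorem clip_sub_clip_le {x y : ℝ} (h : y ≤ x) : clip x - clip y ≤ x - y := by
  simp only [clip, max_def, min_def]
  split_ifs <;> linarith

theorem clip_mono {x y : ℝ} (h : y ≤ x) : clip y ≤ clip x :=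
  max_le_max le_rfl (min_le_min le_rfl h)

theorem sum_transfer_eq_zero {A : Finset (Agent C P)} {o : MarketOutcome C P}
    (hm : IsMatching A o.matching) (h : IsZeroSum A o) : ∑ a ∈ A, o.transfer a = 0 := by
  refine Finset.sum_involution (fun a _ => partner o.matching a) ?_ ?_
    (fun a ha => hm.partner_mem ha) (fun a _ => hm.partner_involutive a)
  · rintro (c | p) ha
    · rcases hp : partner o.matching (Sum.inl c : Agent C P) with c' | p
      · obtain rfl := eq_of_partner_inl_eq_inl hp
        rw [h.2 _ ha hp, add_zero]
      · exact h.1 _ (partner_inl_eq_inr hp)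
    · rcases hp : partner o.matching (Sum.inr p : Agent C P) with c | p'
      · rw [add_comm]
        exact h.1 _ (partner_inr_eq_inl hp)
      · obtain rfl := eq_of_partner_inr_eq_inr hp
        rw [h.2 _ ha hp, add_zero]
  · intro a ha hne heq
    exact hne (h.2 a ha heq)

variable [Fintype C] [Fintype P]

/-- The width of the confidence interval. -/
noncomputable def ciWidth (T : ℕ) {t : ℕ} (h : Fin t → Round C P) (a b : Agent C P) : ℝ :=
  ucb T h a b - lcb T h a b

theorem radius_nonneg (T : ℕ) {t : ℕ} (h : Fin t → Round C P) (a b : Agent C P) :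
    0 ≤ radius T h a b := by
  unfold radius
  positivity

theorem ciWidth_nonneg (T : ℕ) {t : ℕ} (h : Fin t → Round C P) (a b : Agent C P) :
    0 ≤ ciWidth T h a b := by
  have := clip_mono (show empMean h a b - radius T h a b ≤ empMean h a b + radius T h a b by
    linarith [radius_nonneg T h a b])
  unfold ciWidth ucb lcb
  split_ifs <;> linarith

theorem ciWidth_le_two (T : ℕ) {t : ℕ} {h : Fin t → Round C P} {a b : Agent C P}
    (h0 : (matchedRounds h a b).card = 0) : ciWidth T h a b ≤ 2 := by
  unfold ciWidth ucb lcb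
  split_ifs <;> norm_num

theorem ciWidth_le (T : ℕ) {t : ℕ} {h : Fin t → Round C P} {a b : Agent C P}
    (h0 : (matchedRounds h a b).card ≠ 0) : ciWidth T h a b ≤
      16 * (√(Real.log ((Fintype.card (Agent C P) : ℝ) * (T : ℝ))) /
        √((matchedRounds h a b).card : ℝ)) := by
  have hr := radius_nonneg T h a b
  have := clip_sub_clip_le
    (show empMean h a b - radius T h a b ≤ empMean h a b + radius T h a b by linarith)
  rw [← Real.sqrt_div' _ (Nat.cast_nonneg _)]
  unfold ciWidth ucb lcb
  unfold radius at *
  split_ifs <;> linarith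

theorem two_le_card_mul {a b : Agent C P} (hab : a.isLeft ≠ b.isLeft) {T : ℕ} (hT : 0 < T) :
    (2 : ℝ) ≤ (Fintype.card (Agent C P) : ℝ) * (T : ℝ) := by
  have : Nontrivial (Agent C P) := ⟨a, b, fun h => hab (h ▸ rfl)⟩
  have h2 : 2 ≤ Fintype.card (Agent C P) := Fintype.one_lt_card
  exact_mod_cast (show 2 ≤ Fintype.card (Agent C P) * T by nlinarith)

/-- The difference of the roots is `1 / (√(m+1) + √m)`, and `√(m+1) ≤ 2√m` for `m ≥ 1`. This makes
the sum of widths telescope. -/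
theorem one_div_sqrt_le {m : ℕ} (hm : m ≠ 0) :
    1 / √(m : ℝ) ≤ 3 * (√((m + 1 : ℕ) : ℝ) - √(m : ℝ)) := by
  have hm1 : (1 : ℝ) ≤ m := by exact_mod_cast Nat.one_le_iff_ne_zero.mpr hm
  have hs : 1 ≤ √(m : ℝ) := Real.one_le_sqrt.mpr hm1
  have hs2 := Real.sq_sqrt (show (0 : ℝ) ≤ m by linarith)
  have hr2 := Real.sq_sqrt (show (0 : ℝ) ≤ ((m + 1 : ℕ) : ℝ) by positivity)
  have hr0 := Real.sqrt_nonneg ((m + 1 : ℕ) : ℝ)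
  set s := √(m : ℝ)
  set r := √((m + 1 : ℕ) : ℝ)
  push_cast at hr2
  have hr : r ≤ 2 * s := by nlinarith
  have hsr : s ≤ r := by nlinarith
  rw [div_le_iff₀ (by linarith)]
  nlinarith

variable {π : Policy C P} {u : Agent C P → Agent C P → ℝ} {A : ℕ → Finset (Agent C P)}
  {z : ℕ → Agent C P → ℝ}

theorem sum_ciWidth_pair_le {T : ℕ} {a b : Agent C P} (hab : a.isLeft ≠ b.isLeft) :
    ∑ t ∈ Finset.range T, (matchIndicator π u A z a b t : ℝ) * ciWidth T (history π u A z t) a b ≤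
      48 * √(Real.log ((Fintype.card (Agent C P) : ℝ) * (T : ℝ))) *
        √(matchCount π u A z a b T : ℝ) := by
  set L := √(Real.log ((Fintype.card (Agent C P) : ℝ) * (T : ℝ))) with hL
  suffices h : ∀ τ ≤ T, ∑ t ∈ Finset.range τ,
      (matchIndicator π u A z a b t : ℝ) * ciWidth T (history π u A z t) a b ≤
        48 * L * √(matchCount π u A z a b τ : ℝ) from h T le_rfl
  intro τ
  induction τ with
  | zero => simp [matchCount]
  | succ t ih =>
    intro ht
    specialize ih (Nat.le_of_succ_le ht)
    -- Since `|𝒜|T ≥ 2`, the logarithm exceeds `1/4`. Hence `48L ≥ 24` covers the width `2` of an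
    -- interval before the first match.
    have hL2 : 1 / 2 ≤ L := by
      refine Real.le_sqrt_of_sq_le ?_
      have h1 := Real.log_le_log (by norm_num)
        (two_le_card_mul hab (Nat.lt_of_lt_of_le (Nat.succ_pos t) ht))
      have h2 := Real.log_two_gt_d9
      rw [show (1 / 2 : ℝ) ^ 2 = 1 / 4 by norm_num]
      linarith
    rw [Finset.sum_range_succ, matchCount_succ]
    by_cases hI : matchIndicator π u A z a b t = 0
    · simpa [hI] using ih
    have hI1 : matchIndicator π u A z a b t = 1 := by
      unfold matchIndicator at hI ⊢
      split_ifs at hI ⊢ <;> simp_all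
    rw [hI1, Nat.cast_one, one_mul]
    by_cases hm : matchCount π u A z a b t = 0
    · have := ciWidth_le_two T ((card_matchedRounds_history a b t).trans hm)
      simp only [hm, Nat.cast_zero, Real.sqrt_zero, mul_zero, zero_add, Nat.cast_one,
        Real.sqrt_one, mul_one] at ih ⊢
      linarith
    · have h1 := ciWidth_le T (((card_matchedRounds_history (z := z) a b t).trans_ne hm))
      rw [card_matchedRounds_history, ← hL] at h1
      have h2 := mul_le_mul_of_nonneg_left (one_div_sqrt_le hm) (show 0 ≤ 16 * L by linarith)
      have h3 : 16 * (L / √(matchCount π u A z a b t : ℝ)) =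
        16 * L * (1 / √(matchCount π u A z a b t : ℝ)) := by ring
      linarith

theorem sum_ciWidth_round_le (T t : ℕ) :
    ∑ a ∈ A t, ciWidth T (history π u A z t) a (partner (π.play u A z t).matching a) ≤
      ∑ e : Agent C P × Agent C P with e.1.isLeft ≠ e.2.isLeft,
        (matchIndicator π u A z e.1 e.2 t : ℝ) * ciWidth T (history π u A z t) e.1 e.2 := by
  classical
  rw [Finset.sum_filter, Fintype.sum_prod_type]
  refine le_trans (Finset.sum_le_sum fun a _ => ?_) (Finset.sum_le_univ_sum_of_nonneg fun a => ?_)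
  · refine le_trans ?_ (Finset.single_le_sum (fun b _ => ?_)
      (Finset.mem_univ (partner (π.play u A z t).matching a)))
    · rcases (isMatching_play π u A z t).partner_eq_self_or a with h | h
      · simp [h, ciWidth, ucb_self, lcb_self]
      · simp [h.2.2, matchIndicator]
    · split_ifs
      exacts [mul_nonneg (Nat.cast_nonneg _) (ciWidth_nonneg _ _ _ _), le_rfl]
  · refine Finset.sum_nonneg fun b _ => ?_
    split_ifs
    exacts [mul_nonneg (Nat.cast_nonneg _) (ciWidth_nonneg _ _ _ _), le_rfl]

/-- An arrived agent has at most one partner of the other side; an agent who is absent is its own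
partner and contributes nothing. -/
theorem sum_matchIndicator_le (t : ℕ) :
    ∑ e : Agent C P × Agent C P with e.1.isLeft ≠ e.2.isLeft, matchIndicator π u A z e.1 e.2 t ≤
      (A t).card := by
  classical
  rw [Finset.sum_filter, Fintype.sum_prod_type, Finset.card_eq_sum_ones,
    ← Finset.sum_subset (Finset.subset_univ (A t))]
  · refine Finset.sum_le_sum fun a _ => ?_
    calc _ ≤ ∑ b, matchIndicator π u A z a b t :=
          Finset.sum_le_sum fun b _ => by split_ifs <;> simp
      _ = 1 := by simp [matchIndicator]
  · intro a _ ha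
    refine Finset.sum_eq_zero fun b _ => ?_
    split_ifs with hab
    · refine if_neg fun hb => ?_
      rcases (isMatching_play π u A z t).partner_eq_self_or a with h | h
      · exact hab (by rw [← hb]; exact congrArg Sum.isLeft h.symm)
      · exact ha h.1
    · rfl

theorem sum_matchCount_le (T : ℕ) :
    ∑ e : Agent C P × Agent C P with e.1.isLeft ≠ e.2.isLeft, matchCount π u A z e.1 e.2 T ≤
      maxArrivals A T * T := by
  simp only [matchCount]
  rw [Finset.sum_comm, mul_comm]
  refine (Finset.sum_le_card_nsmul _ _ (maxArrivals A T) fun t ht => ?_).trans_eq (by simp)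
  exact (sum_matchIndicator_le t).trans (Finset.le_sup (f := fun t => (A t).card) ht)

theorem sum_sqrt_matchCount_le (T : ℕ) :
    ∑ e : Agent C P × Agent C P with e.1.isLeft ≠ e.2.isLeft,
        √(matchCount π u A z e.1 e.2 T : ℝ) ≤
      (Fintype.card (Agent C P) : ℝ) * √((maxArrivals A T : ℝ) * (T : ℝ)) := by
  set S := (Finset.univ : Finset (Agent C P × Agent C P)).filter
    fun e => e.1.isLeft ≠ e.2.isLeft
  have hcard : (S.card : ℝ) ≤ (Fintype.card (Agent C P) : ℝ) ^ 2 := by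
    have : S.card ≤ Fintype.card (Agent C P) ^ 2 := by
      rw [sq, ← Fintype.card_prod]
      exact Finset.card_le_univ S
    exact_mod_cast this
  have hsum : ∑ e ∈ S, √(matchCount π u A z e.1 e.2 T : ℝ) ^ 2 ≤
      (maxArrivals A T : ℝ) * (T : ℝ) := by
    simp only [Real.sq_sqrt (Nat.cast_nonneg _)]
    exact_mod_cast sum_matchCount_le T
  rw [← Real.sqrt_sq (Nat.cast_nonneg (Fintype.card (Agent C P))),
    ← Real.sqrt_mul (sq_nonneg _)]
  refine Real.le_sqrt_of_sq_le (sq_sum_le_card_mul_sum_sq.trans ?_)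
  exact mul_le_mul hcard hsum (Finset.sum_nonneg fun _ _ => sq_nonneg _) (sq_nonneg _)

theorem IsFrictionUCB.le_revenue {T : ℕ} {ε : ℝ} (hπ : IsFrictionUCB T ε π) :
    ε * (∑ t ∈ Finset.range T, ((A t).card : ℝ)) -
        48 * ((Fintype.card (Agent C P) : ℝ) * √((maxArrivals A T : ℝ) * (T : ℝ)) *
          √(Real.log ((Fintype.card (Agent C P) : ℝ) * (T : ℝ)))) ≤
      π.revenue u A z T := by
  set L := √(Real.log ((Fintype.card (Agent C P) : ℝ) * (T : ℝ))) with hL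
  have hround : ∀ t, ∑ a ∈ A t, (π.play u A z t).transfer a = -(ε * ((A t).card : ℝ)) +
      ∑ a ∈ A t, ciWidth T (history π u A z t) a (partner (π.play u A z t).matching a) := by
    intro t
    obtain ⟨τ, hz, -, hτ⟩ := hπ t (history π u A z t) (A t)
    rw [← play_eq] at hz hτ
    have h0 := sum_transfer_eq_zero (o := ⟨_, τ⟩) (isMatching_play π u A z t) hz
    dsimp only at h0
    rw [Finset.sum_congr rfl hτ, Finset.sum_add_distrib, Finset.sum_sub_distrib, h0]
    simp [ciWidth, mul_comm]
  have hwidth : ∑ t ∈ Finset.range T, ∑ a ∈ A t,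
      ciWidth T (history π u A z t) a (partner (π.play u A z t).matching a) ≤
        48 * ((Fintype.card (Agent C P) : ℝ) * √((maxArrivals A T : ℝ) * (T : ℝ)) * L) := by
    refine (Finset.sum_le_sum fun t _ => sum_ciWidth_round_le T t).trans ?_
    rw [Finset.sum_comm]
    refine (Finset.sum_le_sum fun e he =>
      sum_ciWidth_pair_le (Finset.mem_filter.mp he).2).trans ?_
    rw [← Finset.mul_sum, ← hL]
    have := mul_le_mul_of_nonneg_left (sum_sqrt_matchCount_le (π := π) (u := u) (A := A) (z := z) T)
      (show 0 ≤ 48 * L by positivity)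
    linarith
  unfold Policy.revenue
  rw [Finset.sum_congr rfl fun t _ => hround t, Finset.sum_add_distrib, Finset.sum_neg_distrib,
    ← Finset.mul_sum]
  linarith

end Revenue

/-! ### Deviations of predictably sampled subgaussian noise. -/

section Concentration

variable {Ω : Type*} [mΩ : MeasurableSpace Ω] {μ : Measure Ω}
  {m : ℕ → MeasurableSpace Ω} {η : ℕ → Ω → ℝ} {I : ℕ → Ω → ℕ}

theorem lintegral_exp_le_one {X : Ω → ℝ} (hX : HasSubgaussianMGF X 1 μ) (r : ℝ) :
    ∫⁻ ω, ENNReal.ofReal (Real.exp (r * X ω - r ^ 2 / 2)) ∂μ ≤ 1 := by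
  have hint : Integrable (fun ω => Real.exp (r * X ω) * Real.exp (-(r ^ 2 / 2))) μ :=
    (hX.integrable_exp_mul r).mul_const _
  have hmgf := hX.mgf_le r
  simp only [sub_eq_add_neg, Real.exp_add]
  rw [← ofReal_integral_eq_lintegral_ofReal hint (ae_of_all _ fun ω => by positivity),
    integral_mul_const]
  refine ENNReal.ofReal_le_one.mpr ?_
  calc _ ≤ Real.exp (((1 : NNReal) : ℝ) * r ^ 2 / 2) * Real.exp (-(r ^ 2 / 2)) :=
        mul_le_mul_of_nonneg_right hmgf (Real.exp_nonneg _)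
    _ = 1 := by rw [← Real.exp_add, NNReal.coe_one, one_mul, add_neg_cancel, Real.exp_zero]

/-- The exponential is a supermartingale: in round `t` it is unchanged where `I t = 0`, and where `I
t = 1` it gains a factor independent of `m t` with mean at most `1`. -/
theorem lintegral_exp_predictable_sum_le [IsProbabilityMeasure μ] (hm : Monotone m) (hle : ∀ t, m t ≤ mΩ)
    (hI : ∀ t, Measurable[m t] (I t)) (hI01 : ∀ t ω, I t ω = 0 ∨ I t ω = 1)
    (hη : ∀ t, Measurable[m (t + 1)] (η t))
    (hind : ∀ t, Indep (m t) (MeasurableSpace.comap (η t) inferInstance) μ)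
    (hsub : ∀ t, HasSubgaussianMGF (η t) 1 μ) (r : ℝ) (t : ℕ) :
    ∫⁻ ω, ENNReal.ofReal (Real.exp (r * ∑ s ∈ Finset.range t, (I s ω : ℝ) * η s ω -
      r ^ 2 / 2 * ∑ s ∈ Finset.range t, (I s ω : ℝ))) ∂μ ≤ 1 := by
  have hcast : ∀ t, Measurable[m t] fun ω => (I t ω : ℝ) := fun t =>
    (measurable_from_top (f := fun n : ℕ => (n : ℝ))).comp (hI t)
  induction t with
  | zero => simp
  | succ t ih =>
    set F : Ω → ENNReal := fun ω =>
      ENNReal.ofReal (Real.exp (r * ∑ s ∈ Finset.range t, (I s ω : ℝ) * η s ω -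
        r ^ 2 / 2 * ∑ s ∈ Finset.range t, (I s ω : ℝ))) with hFdef
    have hF : Measurable[m t] F := by
      refine ENNReal.measurable_ofReal.comp (Real.measurable_exp.comp
        (Measurable.sub (Measurable.const_mul ?_ r) (Measurable.const_mul ?_ (r ^ 2 / 2))))
      · refine Finset.measurable_fun_sum _ fun s hs => ?_
        have hs := Finset.mem_range.mp hs
        exact ((hcast s).mono (hm hs.le) le_rfl).mul ((hη s).mono (hm hs) le_rfl)
      · refine Finset.measurable_fun_sum _ fun s hs => ?_
        exact (hcast s).mono (hm (Finset.mem_range.mp hs).le) le_rfl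
    set g : Ω → ENNReal := fun ω => ENNReal.ofReal (Real.exp (r * η t ω - r ^ 2 / 2)) with hgdef
    have hg : Measurable[MeasurableSpace.comap (η t) inferInstance] g :=
      (ENNReal.measurable_ofReal.comp (Real.measurable_exp.comp
        ((measurable_id.const_mul r).sub_const (r ^ 2 / 2)))).comp (comap_measurable (η t))
    have hS : ∀ i, MeasurableSet[m t] {ω | I t ω = i} := fun i => hI t (measurableSet_singleton i)
    set G : ℕ → Ω → ENNReal := fun i => Set.indicator {ω | I t ω = i} F with hGdef
    have hG : ∀ i, Measurable[m t] (G i) := fun i => hF.indicator (hS i)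
    have hηle : MeasurableSpace.comap (η t) inferInstance ≤ mΩ :=
      ((hη t).mono (hle _) le_rfl).comap_le
    have hsplit : ∀ ω, ENNReal.ofReal (Real.exp (r * ∑ s ∈ Finset.range (t + 1),
        (I s ω : ℝ) * η s ω - r ^ 2 / 2 * ∑ s ∈ Finset.range (t + 1), (I s ω : ℝ))) =
        G 0 ω + G 1 ω * g ω := by
      intro ω
      rw [Finset.sum_range_succ, Finset.sum_range_succ]
      rcases hI01 t ω with h | h
      · simp [hGdef, hFdef, h]
      · simp only [hGdef, hFdef, hgdef, h, Set.indicator, Set.mem_ofPred_eq, if_true, one_ne_zero,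
          if_false, Nat.cast_one, one_mul, zero_add]
        rw [← ENNReal.ofReal_mul (Real.exp_nonneg _), ← Real.exp_add]
        congr 2
        ring
    have hsum : ∀ ω, G 0 ω + G 1 ω = F ω := by
      intro ω
      rcases hI01 t ω with h | h <;> simp [hGdef, h]
    simp only [hsplit]
    rw [lintegral_add_left ((hG 0).mono (hle t) le_rfl),
      lintegral_mul_eq_lintegral_mul_lintegral_of_independent_measurableSpace (hle t) hηle
        (hind t) (hG 1) hg]
    calc _ ≤ ∫⁻ ω, G 0 ω ∂μ + (∫⁻ ω, G 1 ω ∂μ) * 1 := by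
          gcongr
          exact lintegral_exp_le_one (hsub t) r
      _ = ∫⁻ ω, F ω ∂μ := by
          rw [mul_one, ← lintegral_add_left ((hG 0).mono (hle t) le_rfl)]
          simp only [hsum]
      _ ≤ 1 := ih

theorem measureReal_predictable_sum_ge_le [IsProbabilityMeasure μ] (hm : Monotone m)
    (hle : ∀ t, m t ≤ mΩ)
    (hI : ∀ t, Measurable[m t] (I t)) (hI01 : ∀ t ω, I t ω = 0 ∨ I t ω = 1)
    (hη : ∀ t, Measurable[m (t + 1)] (η t))
    (hind : ∀ t, Indep (m t) (MeasurableSpace.comap (η t) inferInstance) μ)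
    (hsub : ∀ t, HasSubgaussianMGF (η t) 1 μ) {k : ℕ} (hk : k ≠ 0) {x : ℝ} (hx : 0 ≤ x) (t : ℕ) :
    μ.real {ω | ∑ s ∈ Finset.range t, I s ω = k ∧
      x ≤ ∑ s ∈ Finset.range t, (I s ω : ℝ) * η s ω} ≤ Real.exp (-(x ^ 2 / (2 * k))) := by
  have hk0 : (0 : ℝ) < k := by exact_mod_cast Nat.pos_of_ne_zero hk
  -- This `r` maximizes `r x - r² k / 2`, with value `x² / (2k)`. It must be deterministic, which is
  -- why the count is fixed to `k`.
  set r : ℝ := x / k with hr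
  set F : Ω → ENNReal := fun ω =>
    ENNReal.ofReal (Real.exp (r * ∑ s ∈ Finset.range t, (I s ω : ℝ) * η s ω -
      r ^ 2 / 2 * ∑ s ∈ Finset.range t, (I s ω : ℝ))) with hFdef
  have hF1 : ∫⁻ ω, F ω ∂μ ≤ 1 :=
    lintegral_exp_predictable_sum_le hm hle hI hI01 hη hind hsub r t
  have hcast : ∀ t, Measurable fun ω => (I t ω : ℝ) := fun t =>
    (measurable_from_top (f := fun n : ℕ => (n : ℝ))).comp ((hI t).mono (hle t) le_rfl)
  have hF : Measurable F := by
    refine ENNReal.measurable_ofReal.comp (Real.measurable_exp.comp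
      (Measurable.sub (Measurable.const_mul ?_ r) (Measurable.const_mul ?_ (r ^ 2 / 2))))
    · exact Finset.measurable_fun_sum _ fun s _ =>
        (hcast s).mul ((hη s).mono (hle _) le_rfl)
    · exact Finset.measurable_fun_sum _ fun s _ => hcast s
  set c : ℝ := x ^ 2 / (2 * k) with hc
  have hsub : {ω | ∑ s ∈ Finset.range t, I s ω = k ∧
      x ≤ ∑ s ∈ Finset.range t, (I s ω : ℝ) * η s ω} ⊆
      {ω | ENNReal.ofReal (Real.exp c) ≤ F ω} := by
    rintro ω ⟨h1, h2⟩
    refine ENNReal.ofReal_le_ofReal (Real.exp_le_exp.mpr ?_)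
    have h3 : ∑ s ∈ Finset.range t, (I s ω : ℝ) = k := by exact_mod_cast h1
    rw [h3]
    have h4 : r * x ≤ r * ∑ s ∈ Finset.range t, (I s ω : ℝ) * η s ω :=
      mul_le_mul_of_nonneg_left h2 (div_nonneg hx hk0.le)
    have h5 : r * x - r ^ 2 / 2 * k = c := by
      rw [hr, hc]
      field_simp
      ring
    linarith
  have hmarkov := (mul_meas_ge_le_lintegral₀ hF.aemeasurable
    (ENNReal.ofReal (Real.exp c))).trans hF1
  have hmeas : μ {ω | ENNReal.ofReal (Real.exp c) ≤ F ω} ≤ ENNReal.ofReal (Real.exp (-c)) := by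
    rw [Real.exp_neg, ENNReal.ofReal_inv_of_pos (Real.exp_pos _)]
    rw [mul_comm] at hmarkov
    exact ENNReal.le_inv_iff_mul_le.mpr hmarkov
  exact ENNReal.toReal_le_of_le_ofReal (Real.exp_nonneg _) ((measure_mono hsub).trans hmeas)

theorem measureReal_abs_predictable_sum_ge_le [IsProbabilityMeasure μ] (hm : Monotone m)
    (hle : ∀ t, m t ≤ mΩ)
    (hI : ∀ t, Measurable[m t] (I t)) (hI01 : ∀ t ω, I t ω = 0 ∨ I t ω = 1)
    (hη : ∀ t, Measurable[m (t + 1)] (η t))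
    (hind : ∀ t, Indep (m t) (MeasurableSpace.comap (η t) inferInstance) μ)
    (hsub : ∀ t, HasSubgaussianMGF (η t) 1 μ) {k : ℕ} (hk : k ≠ 0) {x : ℝ} (hx : 0 ≤ x) (t : ℕ) :
    μ.real {ω | ∑ s ∈ Finset.range t, I s ω = k ∧
      x ≤ |∑ s ∈ Finset.range t, (I s ω : ℝ) * η s ω|} ≤ 2 * Real.exp (-(x ^ 2 / (2 * k))) := by
  have hneg : ∀ t, Measurable[MeasurableSpace.comap (η t) inferInstance] (-η t) := fun t =>
    (comap_measurable (η t)).neg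
  have h1 := measureReal_predictable_sum_ge_le hm hle hI hI01 hη hind hsub hk hx t
  have h2 := measureReal_predictable_sum_ge_le (η := fun s => -η s) hm hle hI hI01
    (fun t => (hη t).neg) (fun t => indep_of_indep_of_le_right (hind t) (hneg t).comap_le)
    (fun t => (hsub t).neg) hk hx t
  refine (measureReal_mono (fun ω hω => ?_)).trans
    ((measureReal_union_le _ _).trans ((add_le_add h1 h2).trans_eq (two_mul _).symm))
  rcases le_abs.mp hω.2 with h | h
  · exact .inl ⟨hω.1, h⟩
  · exact .inr ⟨hω.1, by simpa using h⟩

end Concentration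

/-! ### Predictability of the matchings. -/

section PlayMeasurability

variable {C P : Type*} [Finite C] [Finite P] {Ω : Type*} {π : Policy C P}
  {u : Agent C P → Agent C P → ℝ} {A : ℕ → Finset (Agent C P)}

/-- The event splits according to the matchings of all earlier rounds; on each piece the feedback is
an explicit function of the noise. Only noise before round `t` enters, so the σ-algebra of the past
can be used on `Ω`. -/
theorem measurableSet_play_matching_eq [MeasurableSpace Ω] {z : Ω → ℕ → Agent C P → ℝ} (t : ℕ)
    (hz : ∀ s < t, ∀ a, Measurable fun ω => z ω s a) (X : Finset (C × P)) :
    MeasurableSet {ω | (π.play u A (z ω) t).matching = X} := by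
  classical
  induction t using Nat.strong_induction_on generalizing X with
  | _ t ih =>
    let Y : (Fin t → Finset (C × P)) → Ω → Fin t → Agent C P → ℝ := fun Xs ω s a =>
      if a ∈ A s then u a (partner (Xs s) a) + z ω s a else 0
    have hY : ∀ Xs, Measurable (Y Xs) := fun Xs => by
      refine measurable_pi_lambda _ fun s => measurable_pi_lambda _ fun a => ?_
      exact .ite (.const _) ((hz s s.isLt a).const_add _) measurable_const
    have hset : {ω | (π.play u A (z ω) t).matching = X} =
        ⋃ Xs : Fin t → Finset (C × P),
          (⋂ s : Fin t, {ω | (π.play u A (z ω) s).matching = Xs s}) ∩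
          Y Xs ⁻¹' {y | (π.choose t (fun s => ⟨A s, Xs s, y s⟩) (A t)).matching = X} := by
      ext ω
      have hh : ∀ Xs : Fin t → Finset (C × P), (∀ s : Fin t, (π.play u A (z ω) s).matching = Xs s) →
          history π u A (z ω) t = fun s => ⟨A s, Xs s, Y Xs ω s⟩ := by
        intro Xs hXs
        funext s
        simp only [history, hXs s, Y]
      simp only [Set.mem_ofPred_eq, Set.mem_iUnion, Set.mem_inter_iff, Set.mem_iInter,
        Set.mem_preimage]
      rw [play_eq]
      constructor
      · intro h
        refine ⟨fun s => (π.play u A (z ω) s).matching, fun s => rfl, ?_⟩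
        rwa [hh _ fun s => rfl] at h
      · rintro ⟨Xs, hXs, h⟩
        rwa [hh Xs hXs]
    rw [hset]
    refine MeasurableSet.iUnion fun Xs => (MeasurableSet.iInter fun s => ?_).inter
      (hY Xs (π.measurable_matching t _ Xs (A t) X))
    exact ih s s.isLt (fun s' hs' => hz s' (hs'.trans s.isLt)) (Xs s)

theorem measurable_matchIndicator [MeasurableSpace Ω] {z : Ω → ℕ → Agent C P → ℝ} (t : ℕ)
    (hz : ∀ s < t, ∀ a, Measurable fun ω => z ω s a) (a b : Agent C P) :
    Measurable fun ω => matchIndicator π u A (z ω) a b t := by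
  classical
  exact measurable_apply_of_countable (measurableSet_play_matching_eq t hz)
    (f := fun X _ => if partner X a = b then 1 else 0) fun X => measurable_const

end PlayMeasurability

/-! ### The filtration of past noise. -/

section NoiseFiltration

variable {ι Ω : Type*} {noise : ℕ → ι → Ω → ℝ}

/-- The events which are determined by the noise before round `t`. -/
@[reducible]
def pastNoise (noise : ℕ → ι → Ω → ℝ) (t : ℕ) : MeasurableSpace Ω :=
  ⨆ i ∈ {i : ℕ × ι | i.1 < t}, MeasurableSpace.comap (noise i.1 i.2) inferInstance

theorem measurable_pastNoise {s t : ℕ} (hst : s < t) (a : ι) :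
    Measurable[pastNoise noise t] (noise s a) :=
  measurable_iff_comap_le.mpr
    (le_iSup₂_of_le (f := fun (i : ℕ × ι) (_ : i ∈ {i : ℕ × ι | i.1 < t}) =>
      MeasurableSpace.comap (noise i.1 i.2) inferInstance) (s, a) hst le_rfl)

theorem pastNoise_mono : Monotone (pastNoise noise) := fun _ _ hst =>
  biSup_mono fun _ hi => lt_of_lt_of_le hi hst

variable [mΩ : MeasurableSpace Ω] {μ : Measure Ω}

theorem pastNoise_le (hn : ∀ t a, Measurable (noise t a)) (t : ℕ) : pastNoise noise t ≤ mΩ :=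
  iSup₂_le fun i _ => (hn i.1 i.2).comap_le

theorem indep_pastNoise (hn : ∀ t a, Measurable (noise t a))
    (hi : iIndepFun (fun i : ℕ × ι => noise i.1 i.2) μ) (t : ℕ) (a : ι) :
    Indep (pastNoise noise t) (MeasurableSpace.comap (noise t a) inferInstance) μ := by
  have h := indep_iSup_of_disjoint (fun i : ℕ × ι => (hn i.1 i.2).comap_le) hi.iIndep
    (S := {i | i.1 < t}) (T := {(t, a)}) (by simp)
  simpa [pastNoise] using h

end NoiseFiltration

/-! ### Validity of the confidence intervals and stability. -/

section Stability

variable {C P : Type*} {π : Policy C P} {u : Agent C P → Agent C P → ℝ}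
  {A : ℕ → Finset (Agent C P)} {z : ℕ → Agent C P → ℝ}

/-- The sum of the noise in the feedback of `a` before round `t`, over the rounds in which `a` was
matched with `b`. -/
noncomputable def noiseSum (π : Policy C P) (u : Agent C P → Agent C P → ℝ)
    (A : ℕ → Finset (Agent C P)) (z : ℕ → Agent C P → ℝ) (a b : Agent C P) (t : ℕ) : ℝ :=
  ∑ s ∈ Finset.range t, (matchIndicator π u A z a b s : ℝ) * z s a

theorem empMean_history {a b : Agent C P} (hab : a.isLeft ≠ b.isLeft) {t : ℕ}
    (h0 : matchCount π u A z a b t ≠ 0) :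
    empMean (history π u A z t) a b =
      u a b + noiseSum π u A z a b t / (matchCount π u A z a b t : ℝ) := by
  have hm : ((matchCount π u A z a b t : ℕ) : ℝ) ≠ 0 := by exact_mod_cast h0
  have hsum : ∑ s ∈ matchedRounds (history π u A z t) a b, (history π u A z t s).feedback a =
      ∑ s : Fin t, (matchIndicator π u A z a b s : ℝ) * (u a b + z s a) := by
    rw [matchedRounds, Finset.sum_filter]
    refine Finset.sum_congr rfl fun s _ => ?_
    by_cases hs : partner (π.play u A z s).matching a = b
    · have ha : a ∈ A s := by
        rcases (isMatching_play π u A z s).partner_eq_self_or a with h | h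
        · exact absurd (congrArg Sum.isLeft (h.symm.trans hs)) hab
        · exact h.1
      simp [history, matchIndicator, hs, ha]
    · simp [history, matchIndicator, hs]
  rw [empMean, hsum, card_matchedRounds_history, div_eq_iff hm, add_mul, div_mul_cancel₀ _ hm,
    Fin.sum_univ_eq_sum_range fun s => (matchIndicator π u A z a b s : ℝ) * (u a b + z s a)]
  simp only [mul_add, Finset.sum_add_distrib, ← Finset.sum_mul]
  simp [noiseSum, matchCount, mul_comm]

theorem le_clip {x y : ℝ} (hx : x ∈ Set.Icc (-1 : ℝ) 1) (h : x ≤ y) : x ≤ clip y :=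
  le_max_of_le_right (le_min hx.2 h)

theorem clip_le {x y : ℝ} (hx : x ∈ Set.Icc (-1 : ℝ) 1) (h : y ≤ x) : clip y ≤ x :=
  max_le hx.1 ((min_le_right _ _).trans h)

theorem isEpsStable_of_confidence {B : Finset (Agent C P)} {o : MarketOutcome C P}
    {ε : ℝ} {l v : Agent C P → Agent C P → ℝ} {τ : Agent C P → ℝ}
    (hl : ∀ a b, l a b ≤ u a b) (hv : ∀ a b, u a b ≤ v a b)
    (hs : IsStable v B ⟨o.matching, τ⟩)
    (hτ : ∀ a ∈ B, o.transfer a =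
      τ a - ε + (v a (partner o.matching a) - l a (partner o.matching a))) :
    IsEpsStable u ε B o := by
  -- Replacing `v` by `u` loses at most `v - l`, because `l ≤ u`; the transfer pays exactly this
  -- width.
  have hnet : ∀ a ∈ B, netUtility v ⟨o.matching, τ⟩ a - ε ≤ netUtility u o a := by
    intro a ha
    have := hl a (partner o.matching a)
    simp only [netUtility, hτ a ha]
    linarith
  refine ⟨fun a ha => ?_, fun c p hc hp => ?_⟩
  · linarith [hs.1 a ha, hnet a ha]
  · linarith [hs.2 c p hc hp, hnet _ hc, hnet _ hp, hv (Sum.inl c) (Sum.inr p),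
      hv (Sum.inr p) (Sum.inl c)]

theorem IsUnstructured.eq_zero (hu : IsUnstructured u) {a b : Agent C P}
    (hab : a.isLeft = b.isLeft) : u a b = 0 := by
  rcases a with c | p <;> rcases b with c' | p' <;> simp at hab
  exacts [hu.2.1 _ _, hu.2.2 _ _]

variable [Fintype C] [Fintype P]

/-- The event that the noise puts the utility of `a` for `b` outside of the confidence interval of
round `t`, while it was observed `k > 0` times. -/
def deviationEvent {Ω : Type*} (π : Policy C P) (u : Agent C P → Agent C P → ℝ)
    (A : ℕ → Finset (Agent C P)) (noise : ℕ → Agent C P → Ω → ℝ) (T : ℕ) (a b : Agent C P)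
    (t k : ℕ) : Set Ω :=
  {ω | k ≠ 0 ∧ matchCount π u A (fun t a => noise t a ω) a b t = k ∧
    8 * √(Real.log ((Fintype.card (Agent C P) : ℝ) * (T : ℝ)) * k) ≤
      |noiseSum π u A (fun t a => noise t a ω) a b t|}

theorem mem_Icc_lcb_ucb (hu : IsUnstructured u) {T t : ℕ} {a b : Agent C P}
    (h : a.isLeft ≠ b.isLeft → matchCount π u A z a b t ≠ 0 →
      |noiseSum π u A z a b t| ≤ 8 * √(Real.log ((Fintype.card (Agent C P) : ℝ) * (T : ℝ)) *
        (matchCount π u A z a b t : ℝ))) :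
    u a b ∈ Set.Icc (lcb T (history π u A z t) a b) (ucb T (history π u A z t) a b) := by
  unfold lcb ucb
  split_ifs with hab h0
  · simp [hu.eq_zero hab]
  · exact hu.1 a b
  · rw [card_matchedRounds_history] at h0
    have hm : (0 : ℝ) < (matchCount π u A z a b t : ℝ) := by
      exact_mod_cast Nat.pos_of_ne_zero h0
    have hdev : |noiseSum π u A z a b t / (matchCount π u A z a b t : ℝ)| ≤
        radius T (history π u A z t) a b := by
      rw [radius, card_matchedRounds_history, abs_div, abs_of_pos hm, div_le_iff₀ hm]
      refine (h hab h0).trans_eq ?_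
      rw [mul_assoc]
      -- Writing the count as the root of its square turns `√(log / m) * m` into `√(log * m)`.
      nth_rewrite 3 [← Real.sqrt_sq hm.le]
      rw [← Real.sqrt_mul' _ (sq_nonneg _)]
      congr 2
      field_simp
    rw [empMean_history hab h0]
    have := abs_le.mp hdev
    exact ⟨clip_le (hu.1 a b) (by linarith), le_clip (hu.1 a b) (by linarith)⟩

omit [Fintype C] [Fintype P] in
theorem matchCount_lt {a b : Agent C P} {t T : ℕ} (ht : t < T) :
    matchCount π u A z a b t < T := by
  refine lt_of_le_of_lt ?_ ht
  refine (Finset.sum_le_card_nsmul (Finset.range t) _ 1 fun s _ => ?_).trans_eq (by simp)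
  unfold matchIndicator
  split_ifs <;> simp

/-- The event that one of the confidence intervals of the first `T` rounds is too small. -/
def failureEvent {Ω : Type*} (π : Policy C P) (u : Agent C P → Agent C P → ℝ)
    (A : ℕ → Finset (Agent C P)) (noise : ℕ → Agent C P → Ω → ℝ) (T : ℕ) : Set Ω :=
  ⋃ i ∈ ((Finset.univ : Finset (Agent C P × Agent C P)).filter
      fun e => e.1.isLeft ≠ e.2.isLeft) ×ˢ (Finset.range T ×ˢ Finset.range T),
    deviationEvent π u A noise T i.1.1 i.1.2 i.2.1 i.2.2

theorem IsFrictionUCB.isEpsStable {T : ℕ} {ε : ℝ} (hπ : IsFrictionUCB T ε π)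
    (hu : IsUnstructured u) {Ω : Type*} {noise : ℕ → Agent C P → Ω → ℝ} {ω : Ω}
    (hω : ω ∉ failureEvent π u A noise T) {t : ℕ} (ht : t < T) :
    IsEpsStable u ε (A t) (π.play u A (fun t a => noise t a ω) t) := by
  set z : ℕ → Agent C P → ℝ := fun t a => noise t a ω with hz
  have hci : ∀ a b, u a b ∈
      Set.Icc (lcb T (history π u A z t) a b) (ucb T (history π u A z t) a b) := by
    intro a b
    refine mem_Icc_lcb_ucb hu fun hab h0 => ?_
    by_contra! hlt
    refine hω (Set.mem_iUnion₂.mpr ⟨((a, b), (t, matchCount π u A z a b t)), ?_, ?_⟩)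
    · simp [hab, ht, matchCount_lt ht]
    · exact ⟨h0, rfl, hlt.le⟩
  obtain ⟨τ, -, hs, hτ⟩ := hπ t (history π u A z t) (A t)
  rw [← play_eq] at hs hτ
  exact isEpsStable_of_confidence (fun a b => (hci a b).1)
    (fun a b => (hci a b).2) hs hτ

variable {Ω : Type*} [MeasurableSpace Ω] {μ : Measure Ω} [IsProbabilityMeasure μ]
  {noise : ℕ → Agent C P → Ω → ℝ}

theorem measureReal_deviationEvent_le (hn : ∀ t a, Measurable (noise t a))
    (hi : iIndepFun (fun i : ℕ × Agent C P => noise i.1 i.2) μ)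
    (hs : ∀ t a, HasSubgaussianMGF (noise t a) 1 μ) {T : ℕ}
    (hNT : 1 ≤ (Fintype.card (Agent C P) : ℝ) * (T : ℝ)) (a b : Agent C P) (t k : ℕ) :
    μ.real (deviationEvent π u A noise T a b t k) ≤
      2 * (((Fintype.card (Agent C P) : ℝ) * (T : ℝ)) ^ 32)⁻¹ := by
  by_cases hk : k = 0
  · simp only [deviationEvent, hk, ne_eq, not_true, false_and, Set.ofPred_false, measureReal_empty]
    positivity
  have hk0 : (0 : ℝ) < k := by exact_mod_cast Nat.pos_of_ne_zero hk
  have hlog := Real.log_nonneg hNT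
  set x := (Fintype.card (Agent C P) : ℝ) * (T : ℝ) with hx
  have h := measureReal_abs_predictable_sum_ge_le (m := pastNoise noise)
    (η := fun t => noise t a)
    (I := fun s ω => matchIndicator π u A (fun t a => noise t a ω) a b s) pastNoise_mono
    (pastNoise_le hn)
    (fun t => @measurable_matchIndicator _ _ _ _ _ π u A (pastNoise noise t) _ t
      (fun s hs a => measurable_pastNoise hs a) a b)
    (fun t ω => by unfold matchIndicator; split_ifs <;> simp)
    (fun t => measurable_pastNoise (Nat.lt_succ_self t) a)
    (fun t => indep_pastNoise hn hi t a) (fun t => hs t a) hk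
    (show 0 ≤ 8 * √(Real.log x * k) by positivity) t
  -- The exponent is `64 log x · k / (2k) = 32 log x`; the count cancels.
  have hexp : Real.exp (-((8 * √(Real.log x * k)) ^ 2 / (2 * k))) = (x ^ 32)⁻¹ := by
    rw [mul_pow, Real.sq_sqrt (by positivity), Real.exp_neg, ← Real.exp_log
      (show 0 < x ^ 32 by positivity), Real.log_pow]
    congr 2
    push_cast
    field_simp
    ring
  rw [hexp] at h
  refine le_trans (measureReal_mono fun ω hω => ?_) h
  exact ⟨hω.2.1, hω.2.2⟩

theorem measureReal_failureEvent_le (hn : ∀ t a, Measurable (noise t a))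
    (hi : iIndepFun (fun i : ℕ × Agent C P => noise i.1 i.2) μ)
    (hs : ∀ t a, HasSubgaussianMGF (noise t a) 1 μ) (T : ℕ) :
    μ.real (failureEvent π u A noise T) ≤ 1 / 100 := by
  set S := ((Finset.univ : Finset (Agent C P × Agent C P)).filter
      fun e => e.1.isLeft ≠ e.2.isLeft) ×ˢ (Finset.range T ×ˢ Finset.range T) with hS
  -- An empty index set leaves nothing to fail; otherwise there are agents on both sides and a
  -- round, so `x ≥ 2`. The union bound is then `x² · 2x⁻³² ≤ 2 / 2³⁰`.
  rcases S.eq_empty_or_nonempty with hempty | ⟨i, hi'⟩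
  · rw [failureEvent, ← hS, hempty]
    simp
  simp only [hS, Finset.mem_product, Finset.mem_filter, Finset.mem_range] at hi'
  have h2 := two_le_card_mul hi'.1.2 (Nat.lt_of_le_of_lt (Nat.zero_le _) hi'.2.1)
  set x := (Fintype.card (Agent C P) : ℝ) * (T : ℝ) with hx
  have hcard : (S.card : ℝ) ≤ x ^ 2 := by
    have h1 : S.card ≤ (Fintype.card (Agent C P) * Fintype.card (Agent C P)) * (T * T) := by
      rw [hS, Finset.card_product, Finset.card_product, Finset.card_range, ← Fintype.card_prod]
      exact Nat.mul_le_mul_right _ (Finset.card_le_univ _)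
    calc (S.card : ℝ) ≤ ((Fintype.card (Agent C P) * Fintype.card (Agent C P)) * (T * T) : ℕ) := by
          exact_mod_cast h1
      _ = x ^ 2 := by push_cast; ring
  have hx30 : (2 : ℝ) ^ 30 ≤ x ^ 30 := pow_le_pow_left₀ (by norm_num) h2 30
  calc μ.real (failureEvent π u A noise T) ≤ ∑ i ∈ S, 2 * (x ^ 32)⁻¹ :=
        (measureReal_biUnion_finset_le _ _).trans (Finset.sum_le_sum fun i _ =>
          measureReal_deviationEvent_le hn hi hs (by linarith) _ _ _ _)
    _ = S.card * (2 * (x ^ 32)⁻¹) := by rw [Finset.sum_const, nsmul_eq_mul]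
    _ ≤ x ^ 2 * (2 * (x ^ 32)⁻¹) := by gcongr
    _ = 2 / x ^ 30 := by
        have : x ≠ 0 := by linarith
        field_simp
    _ ≤ 1 / 100 := by
        rw [div_le_div_iff₀ (by positivity) (by norm_num)]
        norm_num at hx30 ⊢
        linarith

theorem IsFrictionUCB.measureReal_isEpsStable_ge {T : ℕ} {ε : ℝ} (hπ : IsFrictionUCB T ε π)
    (hu : IsUnstructured u) (hn : ∀ t a, Measurable (noise t a))
    (hi : iIndepFun (fun i : ℕ × Agent C P => noise i.1 i.2) μ)
    (hs : ∀ t a, HasSubgaussianMGF (noise t a) 1 μ) :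
    0.99 ≤ μ.real {ω | ∀ t < T, IsEpsStable u ε (A t) (π.play u A (fun t a => noise t a ω) t)} := by
  -- Covering the whole space and using subadditivity avoids any need for measurability of the two
  -- events.
  have hcover : (Set.univ : Set Ω) ⊆ {ω | ∀ t < T, IsEpsStable u ε (A t)
      (π.play u A (fun t a => noise t a ω) t)} ∪ failureEvent π u A noise T := by
    intro ω _
    by_cases hω : ω ∈ failureEvent π u A noise T
    · exact .inr hω
    · exact .inl fun t ht => hπ.isEpsStable hu hω ht
  have h := (measureReal_mono (μ := μ) hcover).trans (measureReal_union_le _ _)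
  have hf := measureReal_failureEvent_le (π := π) (u := u) (A := A) hn hi hs T
  rw [probReal_univ] at h
  norm_num at h hf ⊢
  linarith

end Stability

end MatchingMarket

theorem theorem6p2 :
    ∃ K : ℝ, 0 < K ∧
      ∀ (C P : Type*) [Fintype C] [Fintype P] (T : ℕ) (ε : ℝ), 0 ≤ ε →
        ∃ π : MatchingMarket.Policy C P,
          MatchingMarket.IsFrictionUCB T ε π ∧
          ∀ u : MatchingMarket.Agent C P → MatchingMarket.Agent C P → ℝ,
            MatchingMarket.IsUnstructured u →
          ∀ A : ℕ → Finset (MatchingMarket.Agent C P),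
          ∀ (Ω : Type*) [MeasurableSpace Ω] (μ : Measure Ω) [IsProbabilityMeasure μ]
            (noise : ℕ → MatchingMarket.Agent C P → Ω → ℝ),
            (∀ t a, Measurable (noise t a)) →
            iIndepFun (fun i : ℕ × MatchingMarket.Agent C P => noise i.1 i.2) μ →
            (∀ t a, HasSubgaussianMGF (noise t a) 1 μ) →
            (∀ ω, ε * (∑ t ∈ Finset.range T, ((A t).card : ℝ)) -
                K * ((Fintype.card (MatchingMarket.Agent C P) : ℝ) *
                  √((MatchingMarket.maxArrivals A T : ℝ) * (T : ℝ)) *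
                  √(Real.log ((Fintype.card (MatchingMarket.Agent C P) : ℝ) * (T : ℝ)))) ≤
              π.revenue u A (fun t a => noise t a ω) T) ∧
            0.99 ≤ μ.real {ω | ∀ t < T, MatchingMarket.IsEpsStable u ε (A t)
              (π.play u A (fun t a => noise t a ω) t)} := by
  -- `48 = 16 · 3`: twice the radius constant `8`, times the constant of `one_div_sqrt_le`.
  refine ⟨48, by norm_num, fun C P _ _ T ε _ => ⟨MatchingMarket.ucbPolicy C P T ε,
    MatchingMarket.isFrictionUCB_ucbPolicy T ε, fun u hu A Ω _ μ _ noise hn hi hs =>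
      ⟨fun ω => ?_, ?_⟩⟩⟩
  · exact (MatchingMarket.isFrictionUCB_ucbPolicy T ε).le_revenue
  · exact (MatchingMarket.isFrictionUCB_ucbPolicy T ε).measureReal_isEpsStable_ge hu hn hi hs
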